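/- Let $\mathbb O_s$ be the algebra of split octonions over $\mathbb R$, with scalar part $\operatorname{Re}$, and let $\operatorname{Im}\mathbb O_s$ be its $7$-dimensional space of imaginary elements. On $\operatorname{Im}\mathbb O_s$ consider the $3$-form $\Omega_0(p,q,r)=B(pq,r)$, where $B(p,q)=\operatorname{Re}(pq)$; equivalently $\Omega_0(p,q,r)=\operatorname{Re}((pq)r)$. A $3$-form $\Omega$ on $\mathbb R^7$ is called a (split) $G_2$-structure if $\Omega=\varphi^*\Omega_0$ for some linear isomorphism $\varphi:\mathbb R^7\to\operatorname{Im}\mathbb O_s$. Let $I\subset\mathbb R$ be an open interval and let $\gamma:I\to P^6=P(\mathbb R^7)$ be a smooth non-degenerate (immersed) curve: near every point of $I$ it has a smooth lift $v$ to $\mathbb R^7$, $\gamma=\langle v\rangle$, such that $v,v',\dots,v^{(6)}$ are linearly independent. Let $\gamma^{(j)}(t)$ be the osculating subspace spanned by $v(t),v'(t),\dots,v^{(j)}(t)$, and write $\gamma''=\gamma^{(2)}$. The curve is compatible with $\Omega$ if $\Omega(\gamma,\gamma'',\cdot)=0$, that is, $\Omega(a,b,w)=0$ for all $t\in I$, $a\in\gamma(t)$,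 $b\in\gamma''(t)$, $w\in\mathbb R^7$. Number the rows and columns of $7\times7$ matrices by $0,\dots,6$. Let $x=\sum_{i=0}^{5}E_{i+1,i}$, $h=\operatorname{diag}(6,4,2,0,-2,-4,-6)$, $y=\sum_{i=0}^{5}(i+1)(6-i)E_{i,i+1}$ be the standard basis of the irreducible $\mathfrak{sl}(2,\mathbb R)\subset\mathfrak{sl}(7,\mathbb R)$. A canonical frame of $\gamma$ (with respect to the parameter $t$) is a smooth map $F:I\to SL(7,\mathbb R)$ whose first column spans $\gamma(t)$ and which satisfies $$F^{-1}F'\equiv x+\sum_{i=3}^{7}\theta_i(t)\,y^{\,i-1}\pmod{\langle h,y\rangle}\qquad\text{for all }t\in I ;$$ the functions $\theta_3,\dots,\theta_7$ are the Wilczynski invariants of $\gamma$ in the parameter $t$. Then a canonical frame exists, so that the Wilczynski invariants are defined, and for the functions $\theta_3,\dots,\theta_7$ given by any canonical frame the following are equivalent: there is a $G_2$-structure $\Omega$ on $\mathbb R^7$ with which $\gamma$ is compatible; the Wilczynski invariants $\theta_3,\theta_4,\theta_5,\theta_7$ (all except $\theta_6$) vanish identically on $I$. -/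

import Mathlib

open scoped ContDiff LinearAlgebra.Projectivization Matrix

/-! ## Split octonions and the split `G₂` three-form -/

/-- The underlying vector space of the split octonions, in Zorn's vector-matrix model: the
quadruple `(a, u, v, b)` is the vector matrix with rows `a, u` and `v, b`. -/
abbrev SplitOct : Type := ℝ × (Fin 3 → ℝ) × (Fin 3 → ℝ) × ℝ

/-- Zorn's multiplication of vector matrices, which is the multiplication of split octonions. -/
def SplitOct.mul (p q : SplitOct) : SplitOct :=
  (p.1 * q.1 + p.2.1 ⬝ᵥ q.2.2.1,
    p.1 • q.2.1 + q.2.2.2 • p.2.1 - p.2.2.1 ⨯₃ q.2.2.1,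
    q.1 • p.2.2.1 + p.2.2.2 • q.2.2.1 + p.2.1 ⨯₃ q.2.1,
    p.2.2.2 * q.2.2.2 + p.2.2.1 ⬝ᵥ q.2.1)

/-- The scalar part of a split octonion; the unit is `(1, 0, 0, 1)`. -/
noncomputable def SplitOct.re : SplitOct →ₗ[ℝ] ℝ where
  toFun p := (p.1 + p.2.2.2) / 2
  map_add' p q := by simp only [Prod.fst_add, Prod.snd_add]; ring
  map_smul' c p := by
    simp only [Prod.smul_fst, Prod.smul_snd, smul_eq_mul, RingHom.id_apply]; ring

/-- The `7`-dimensional space of imaginary split octonions. -/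
noncomputable abbrev ImSplitOct : Submodule ℝ SplitOct := LinearMap.ker SplitOct.re

theorem SplitOct.add_mul (p q r : SplitOct) : mul (p + q) r = mul p r + mul q r := by
  simp only [mul, Prod.ext_iff, Prod.fst_add, Prod.snd_add, add_dotProduct, map_add,
    LinearMap.add_apply, smul_add, add_smul]
  refine ⟨by ring, by abel, by abel, by ring⟩

theorem SplitOct.mul_add (p q r : SplitOct) : mul p (q + r) = mul p q + mul p r := by
  simp only [mul, Prod.ext_iff, Prod.fst_add, Prod.snd_add, dotProduct_add, map_add,
    smul_add, add_smul]
  refine ⟨by ring, by abel, by abel, by ring⟩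

theorem SplitOct.smul_mul (c : ℝ) (p q : SplitOct) : mul (c • p) q = c • mul p q := by
  simp only [mul, Prod.ext_iff, Prod.smul_fst, Prod.smul_snd, smul_dotProduct, map_smul,
    LinearMap.smul_apply, smul_add, smul_sub, smul_eq_mul, smul_smul, mul_comm c]
  refine ⟨by ring, trivial, trivial, by ring⟩

theorem SplitOct.mul_smul (c : ℝ) (p q : SplitOct) : mul p (c • q) = c • mul p q := by
  simp only [mul, Prod.ext_iff, Prod.smul_fst, Prod.smul_snd, dotProduct_smul, map_smul,
    smul_add, smul_sub, smul_eq_mul, smul_smul, mul_comm c]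
  refine ⟨by ring, trivial, trivial, by ring⟩

theorem SplitOct.re_mul_mul_alt (p q : SplitOct) (hp : re p = 0) (hq : re q = 0) :
    re (mul (mul p p) q) = 0 ∧ re (mul (mul p q) q) = 0 ∧ re (mul (mul p q) p) = 0 := by
  obtain ⟨a, u, v, b⟩ := p
  obtain ⟨c, r, s, d⟩ := q
  simp only [re, LinearMap.coe_mk, AddHom.coe_mk] at hp hq
  obtain rfl : b = -a := by linarith
  obtain rfl : d = -c := by linarith
  refine ⟨?_, ?_, ?_⟩ <;>
  · simp only [re, LinearMap.coe_mk, AddHom.coe_mk, mul, dotProduct, Fin.sum_univ_three,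
      crossProduct, LinearMap.mk₂_apply, Pi.add_apply, Pi.sub_apply, Pi.smul_apply, smul_eq_mul,
      Matrix.cons_val_zero, Matrix.cons_val_one, Matrix.cons_val]
    ring

/-- The `3`-form `Ω(p, q, r) = B(p q, r)` on imaginary split octonions, where `B(p, q)` is the
scalar part of `p q`. As `r` is imaginary, this is the scalar part of `(p q) r`. -/
noncomputable def splitG2Form : ImSplitOct [⋀^Fin 3]→ₗ[ℝ] ℝ where
  toFun m := SplitOct.re (SplitOct.mul (SplitOct.mul (m 0) (m 1)) (m 2))
  map_update_add' m i p q := by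
    rename_i inst
    obtain rfl : inst = instDecidableEqFin 3 := Subsingleton.elim _ _
    fin_cases i <;> simp [SplitOct.add_mul, SplitOct.mul_add]
  map_update_smul' m i c p := by
    rename_i inst
    obtain rfl : inst = instDecidableEqFin 3 := Subsingleton.elim _ _
    fin_cases i <;> simp [SplitOct.smul_mul, SplitOct.mul_smul]
  map_eq_zero_of_eq' m i j hm hij := by
    have h (p q : ImSplitOct) := SplitOct.re_mul_mul_alt p q p.2 q.2
    fin_cases i <;> fin_cases j <;> simp_all

/-- A `3`-form on `ℝ⁷` is a (split) `G₂`-structure if some linear isomorphism from `ℝ⁷` to the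
imaginary split octonions pulls `splitG2Form` back to it. -/
def IsG2Structure (Ω : (Fin 7 → ℝ) [⋀^Fin 3]→ₗ[ℝ] ℝ) : Prop :=
  ∃ φ : (Fin 7 → ℝ) ≃ₗ[ℝ] ImSplitOct, Ω = splitG2Form.compLinearMap φ.toLinearMap

/-! ## Non-degenerate curves in `P⁶` -/

/-- `v` is a smooth lift to `ℝ⁷` of the parametrized curve `γ` over the set `J`. -/
def IsSmoothLift (γ : ℝ → ℙ ℝ (Fin 7 → ℝ)) (J : Set ℝ) (v : ℝ → Fin 7 → ℝ) : Prop :=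
  ContDiffOn ℝ ∞ v J ∧ ∀ t ∈ J, ∃ hv : v t ≠ 0, Projectivization.mk ℝ (v t) hv = γ t

/-- `γ` is a smooth non-degenerate curve in `P⁶` over the open set `I` of parameters: near every
point it has a smooth lift `v` such that `v, v', …, v⁽⁶⁾` form a basis of `ℝ⁷`. -/
def IsNondegenerateCurve (γ : ℝ → ℙ ℝ (Fin 7 → ℝ)) (I : Set ℝ) : Prop :=
  ∀ t ∈ I, ∃ (J : Set ℝ) (v : ℝ → Fin 7 → ℝ), IsOpen J ∧ t ∈ J ∧ IsSmoothLift γ J v ∧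
    ∀ s ∈ J, LinearIndependent ℝ fun i : Fin 7 => iteratedDeriv i v s

/-- The osculating subspace `γ⁽ʲ⁾(t)`, spanned by the derivatives of order at most `j` of lifts
of `γ` near `t`. All lifts span the same subspace. -/
def osculatingSpace (γ : ℝ → ℙ ℝ (Fin 7 → ℝ)) (j : ℕ) (t : ℝ) : Submodule ℝ (Fin 7 → ℝ) :=
  Submodule.span ℝ {w | ∃ (J : Set ℝ) (v : ℝ → Fin 7 → ℝ), IsOpen J ∧ t ∈ J ∧
    IsSmoothLift γ J v ∧ ∃ i ≤ j, w = iteratedDeriv i v t}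

/-- The curve `γ` is compatible with the `3`-form `Ω`: `Ω(γ, γ'', ·) = 0`. -/
def IsCompatible (γ : ℝ → ℙ ℝ (Fin 7 → ℝ)) (I : Set ℝ)
    (Ω : (Fin 7 → ℝ) [⋀^Fin 3]→ₗ[ℝ] ℝ) : Prop :=
  ∀ t ∈ I, ∀ a ∈ osculatingSpace γ 0 t, ∀ b ∈ osculatingSpace γ 2 t, ∀ w, Ω ![a, b, w] = 0

/-! ## Canonical frames and Wilczynski invariants -/

/-- The element `x` of the irreducible `sl₂` in `sl₇`: ones below the diagonal. -/
def sl2X : Matrix (Fin 7) (Fin 7) ℝ :=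
  Matrix.of fun i j => if (i : ℕ) = j + 1 then 1 else 0

/-- The element `h = diag(6, 4, …, -6)`. -/
def sl2H : Matrix (Fin 7) (Fin 7) ℝ :=
  Matrix.diagonal fun i => 6 - 2 * (i : ℝ)

/-- The element `y`, with entries `6, 10, 12, 12, 10, 6` above the diagonal. -/
def sl2Y : Matrix (Fin 7) (Fin 7) ℝ :=
  Matrix.of fun i j => if (j : ℕ) = i + 1 then ((i : ℝ) + 1) * (6 - i) else 0

/-- `F` is a canonical moving frame of the curve `γ` with respect to the given parameter, and the
functions `θ 3, …, θ 7` are the coefficients that it defines: `F` is a smooth function with values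
in `SL(7, ℝ)`, its first column spans `γ`, and
`F⁻¹ F' = x + θ₃ y² + θ₄ y³ + θ₅ y⁴ + θ₆ y⁵ + θ₇ y⁶` modulo `⟨h, y⟩`. -/
structure IsCanonicalFrame (γ : ℝ → ℙ ℝ (Fin 7 → ℝ)) (I : Set ℝ)
    (F : ℝ → Matrix (Fin 7) (Fin 7) ℝ) (θ : ℕ → ℝ → ℝ) : Prop where
  smooth : ∀ i j, ContDiffOn ℝ ∞ (fun t => F t i j) I
  det_eq_one : ∀ t ∈ I, (F t).det = 1
  lifts : ∀ t ∈ I, ∃ h0 : (fun i => F t i 0) ≠ 0,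
    Projectivization.mk ℝ (fun i => F t i 0) h0 = γ t
  structure_eq : ∀ t ∈ I, ∃ b c : ℝ, ∀ i j,
    HasDerivAt (fun s => F s i j)
      ((F t * (sl2X + b • sl2H + c • sl2Y +
        ∑ m ∈ Finset.Icc 3 7, θ m t • sl2Y ^ (m - 1))) i j) t

/-- The functions `θ 3, …, θ 7` are the Wilczynski invariants of the curve `γ` (with respect to
the given parameter). -/
def IsWilczynskiInvariants (γ : ℝ → ℙ ℝ (Fin 7 → ℝ)) (I : Set ℝ) (θ : ℕ → ℝ → ℝ) : Prop :=
  ∃ F : ℝ → Matrix (Fin 7) (Fin 7) ℝ, IsCanonicalFrame γ I F θ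

/-! ## Powers of `y` and the matrix of a canonical frame -/

/-! Under the irreducible `sl₂`, the algebra `sl₇` splits into components of dimension 3, 5, 7, 9,
11, 13 with extreme vectors y, y², …, y⁶. The split form of `g₂` containing this `sl₂` is the sum of
the components of y and y⁵. Since θᵢ multiplies yⁱ⁻¹, the vanishing of all invariants but θ₆ says
that A = F⁻¹F′ takes values in `g₂`, the annihilator of the invariant three-form `invariantForm`.

If it does (`invariantForm_canonicalMatrix`), transporting the invariant form by F⁻¹ gives a form
independent of t, because I is connected. This is a `G₂`-structure, and it kills F₀ ∧ F₁ since the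
invariant form kills e₀ ∧ e₁. By differentiation that already gives compatibility
(`isCompatible_of_frame_eq_zero`).

Conversely, a fixed form Ω has coefficients Ω(Fᵢ, Fⱼ, Fₖ) that satisfy a linear differential system
with matrix A. Compatibility makes those with indices 0, 1 vanish. Sweeping through the coefficients
by index sum (`threeForm_system`) forces them to be a multiple of the invariant form, and the
redundant equations say that this multiple annihilates θ₃, θ₄, θ₅, θ₇. The multiple is nowhere zero
because Ω ≠ 0.

Canonical frames exist because γ has a global lift with Wronskian determinant 1
(`exists_normalized_lift`), whose Wronskian frame is corrected by unipotent gauge transformations,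
one superdiagonal at a time (`IsNormalizedFrame.exists_succ`). -/

theorem sl2Y_apply (i j : Fin 7) :
    sl2Y i j = if (j : ℕ) = i + 1 then ((i : ℝ) + 1) * (6 - i) else 0 := rfl

theorem sl2Y_pow_apply (k : ℕ) (i j : Fin 7) : (sl2Y ^ k) i j =
    if (j : ℕ) = i + k then ∏ l ∈ Finset.range k, ((i + l : ℝ) + 1) * (6 - (i + l)) else 0 := by
  induction k generalizing j with
  | zero => simp [Matrix.one_apply, Fin.ext_iff, eq_comm]
  | succ k ih =>
    rw [pow_succ, Matrix.mul_apply]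
    simp only [ih, sl2Y_apply, ite_mul, zero_mul]
    split_ifs with h
    · have hl : (i : ℕ) + k < 7 := by omega
      rw [Finset.sum_eq_single (⟨i + k, hl⟩ : Fin 7)]
      · rw [Finset.prod_range_succ]
        simp [h, add_assoc]
      · intro l _ hne
        rw [if_neg]
        exact fun h' => hne (Fin.ext h')
      · simp
    · refine Finset.sum_eq_zero fun l _ => ?_
      split_ifs with h1 h2
      · omega
      · simp
      · rfl

/-- Positivity is what later makes the entry sum of yᵏ nonzero, so that yᵏ spans a complement to the
commutators with x. -/
theorem sl2Y_pow_pos (k : ℕ) (i j : Fin 7) (h : (j : ℕ) = i + k) : 0 < (sl2Y ^ k) i j := by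
  rw [sl2Y_pow_apply, if_pos h]
  refine Finset.prod_pos fun l hl => ?_
  have h6 : (i : ℕ) + l < 6 := by
    have := Finset.mem_range.1 hl
    omega
  have h6' : (i + l : ℝ) < 6 := by exact_mod_cast h6
  have : 0 < 6 - (i + l : ℝ) := by linarith
  positivity

/-- The matrix `x + b h + c y + θ₃ y² + ⋯ + θ₇ y⁶`. -/
noncomputable def canonicalMatrix (b c : ℝ) (θ : ℕ → ℝ) : Matrix (Fin 7) (Fin 7) ℝ :=
  sl2X + b • sl2H + c • sl2Y + ∑ m ∈ Finset.Icc 3 7, θ m • sl2Y ^ (m - 1)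

theorem canonicalMatrix_eq (b c : ℝ) (θ : ℕ → ℝ) :
    canonicalMatrix b c θ =
      !![6 * b, 6 * c, 60 * θ 3, 720 * θ 4, 8640 * θ 5, 86400 * θ 6, 518400 * θ 7;
        1, 4 * b, 10 * c, 120 * θ 3, 1440 * θ 4, 14400 * θ 5, 86400 * θ 6;
        0, 1, 2 * b, 12 * c, 144 * θ 3, 1440 * θ 4, 8640 * θ 5;
        0, 0, 1, 0, 12 * c, 120 * θ 3, 720 * θ 4;
        0, 0, 0, 1, -2 * b, 10 * c, 60 * θ 3;
        0, 0, 0, 0, 1, -4 * b, 6 * c;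
        0, 0, 0, 0, 0, 1, -6 * b] := by
  have h : Finset.Icc 3 7 = {3, 4, 5, 6, 7} := by decide
  rw [canonicalMatrix, h, ← pow_one sl2Y]
  ext i j
  simp only [Finset.sum_insert, Finset.sum_singleton, Finset.mem_insert, Finset.mem_singleton,
    Nat.reduceEqDiff, Nat.reduceSub, or_self, not_false_eq_true, ← pow_mul, one_mul,
    Matrix.add_apply, Matrix.smul_apply, sl2Y_pow_apply, smul_eq_mul, sl2X, sl2H,
    Matrix.diagonal_apply, Matrix.of_apply, Finset.prod_range_succ, Finset.prod_range_zero]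
  fin_cases i <;> fin_cases j <;> norm_num [mul_comm]

/-! ## Derivatives of multilinear forms along moving frames -/

/-- Expanding in the standard basis makes the form a polynomial in the coordinates. Continuity is
needed to apply the product rule for continuous multilinear maps. -/
theorem MultilinearMap.continuous_pi_real {k n : ℕ}
    (f : MultilinearMap ℝ (fun _ : Fin k => Fin n → ℝ) ℝ) : Continuous f := by
  have h : ∀ m : Fin k → Fin n → ℝ, f m = ∑ r : Fin k → Fin n,
      (∏ i, m i (r i)) • f fun i => Pi.single (r i) (1 : ℝ) := by
    intro m
    have hm : m = fun i => ∑ j, m i j • (Pi.single j (1 : ℝ) : Fin n → ℝ) := by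
      funext i
      exact pi_eq_sum_univ' (m i)
    conv_lhs => rw [hm]
    rw [MultilinearMap.map_sum]
    exact Finset.sum_congr rfl fun r _ => MultilinearMap.map_smul_univ _ _ _
  rw [funext h]
  fun_prop

theorem MultilinearMap.hasDerivAt_pi_real {k n : ℕ}
    (f : MultilinearMap ℝ (fun _ : Fin k => Fin n → ℝ) ℝ) {g : Fin k → ℝ → Fin n → ℝ}
    {g' : Fin k → Fin n → ℝ} {t : ℝ} (hg : ∀ i, HasDerivAt (g i) (g' i) t) :
    HasDerivAt (fun s => f fun i => g i s)
      (∑ i, f (Function.update (fun i => g i t) i (g' i))) t := by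
  let Φ : ContinuousMultilinearMap ℝ (fun _ : Fin k => Fin n → ℝ) ℝ :=
    ⟨f, f.continuous_pi_real⟩
  have h1 := (HasFDerivAt.multilinear_comp (f := Φ) fun i => (hg i).hasFDerivAt).hasDerivAt
  refine h1.congr_deriv ?_
  simp [Φ, ContinuousMultilinearMap.toContinuousLinearMap]

theorem AlternatingMap.hasDerivAt_three {n : ℕ} (Ω : (Fin n → ℝ) [⋀^Fin 3]→ₗ[ℝ] ℝ)
    {u v w : ℝ → Fin n → ℝ} {u' v' w' : Fin n → ℝ} {t : ℝ} (hu : HasDerivAt u u' t)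
    (hv : HasDerivAt v v' t) (hw : HasDerivAt w w' t) :
    HasDerivAt (fun s => Ω ![u s, v s, w s])
      (Ω ![u', v t, w t] + Ω ![u t, v', w t] + Ω ![u t, v t, w']) t := by
  have h : ∀ i : Fin 3, HasDerivAt (![u, v, w] i) (![u', v', w'] i) t := by
    intro i
    fin_cases i
    exacts [hu, hv, hw]
  have h1 := Ω.toMultilinearMap.hasDerivAt_pi_real h
  have e : ∀ s, (fun i => ![u, v, w] i s) = ![u s, v s, w s] := by
    intro s
    funext i
    fin_cases i <;> rfl
  simp only [e, Fin.sum_univ_three, AlternatingMap.coe_multilinearMap] at h1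
  refine h1.congr_deriv ?_
  have e0 : Function.update ![u t, v t, w t] 0 u' = ![u', v t, w t] := by
    funext i
    fin_cases i <;> rfl
  have e1 : Function.update ![u t, v t, w t] 1 v' = ![u t, v', w t] := by
    funext i
    fin_cases i <;> rfl
  have e2 : Function.update ![u t, v t, w t] 2 w' = ![u t, v t, w'] := by
    funext i
    fin_cases i <;> rfl
  exact congrArg₂ (· + ·) (congrArg₂ (· + ·) (congrArg Ω e0) (congrArg Ω e1)) (congrArg Ω e2)

/-! ## Three-forms along a canonical frame -/

/-- An alternating array vanishes if its entries with increasing indices do. -/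
theorem alternatingArray_eq_zero {f : Fin 7 → Fin 7 → Fin 7 → ℝ}
    (h12 : ∀ i j k, f i j k = -f j i k) (h23 : ∀ i j k, f i j k = -f i k j)
    (h : ∀ t ∈ ([
    (0, 1, 2), (0, 1, 3), (0, 1, 4), (0, 1, 5), (0, 1, 6), (0, 2, 3), (0, 2, 4), (0, 2, 5),
    (0, 2, 6), (0, 3, 4), (0, 3, 5), (0, 3, 6), (0, 4, 5), (0, 4, 6), (0, 5, 6), (1, 2, 3),
    (1, 2, 4), (1, 2, 5), (1, 2, 6), (1, 3, 4), (1, 3, 5), (1, 3, 6), (1, 4, 5), (1, 4, 6),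
    (1, 5, 6), (2, 3, 4), (2, 3, 5), (2, 3, 6), (2, 4, 5), (2, 4, 6), (2, 5, 6), (3, 4, 5),
    (3, 4, 6), (3, 5, 6), (4, 5, 6)] : List (Fin 7 × Fin 7 × Fin 7)), f t.1 t.2.1 t.2.2 = 0) :
    ∀ i j k, f i j k = 0 := by
  have a1 : ∀ i k, f i i k = 0 := fun i k => by linarith [h12 i i k]
  have a2 : ∀ i k, f i k k = 0 := fun i k => by linarith [h23 i k k]
  have hmem : ∀ i j k : Fin 7, i < j → j < k → (i, j, k) ∈ ([
    (0, 1, 2), (0, 1, 3), (0, 1, 4), (0, 1, 5), (0, 1, 6), (0, 2, 3), (0, 2, 4), (0, 2, 5),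
    (0, 2, 6), (0, 3, 4), (0, 3, 5), (0, 3, 6), (0, 4, 5), (0, 4, 6), (0, 5, 6), (1, 2, 3),
    (1, 2, 4), (1, 2, 5), (1, 2, 6), (1, 3, 4), (1, 3, 5), (1, 3, 6), (1, 4, 5), (1, 4, 6),
    (1, 5, 6), (2, 3, 4), (2, 3, 5), (2, 3, 6), (2, 4, 5), (2, 4, 6), (2, 5, 6), (3, 4, 5),
    (3, 4, 6), (3, 5, 6), (4, 5, 6)] : List (Fin 7 × Fin 7 × Fin 7)) := by
    decide
  have hsorted : ∀ i j k, i < j → j < k → f i j k = 0 := fun i j k hij hjk =>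
    h _ (hmem i j k hij hjk)
  intro i j k
  rcases lt_trichotomy i j with hij | rfl | hij
  · rcases lt_trichotomy j k with hjk | rfl | hjk
    · exact hsorted i j k hij hjk
    · exact a2 _ _
    · rw [h23]
      rcases lt_trichotomy i k with hik | rfl | hik
      · rw [hsorted i k j hik hjk, neg_zero]
      · rw [a1, neg_zero]
      · rw [h12, hsorted k i j hik hij, neg_zero, neg_zero]
  · exact a1 _ _
  · rw [h12]
    rcases lt_trichotomy i k with hik | rfl | hik
    · rw [hsorted j i k hij hik, neg_zero]
    · rw [a2, neg_zero]
    · rw [h23]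
      rcases lt_trichotomy j k with hjk | rfl | hjk
      · rw [hsorted j k i hjk hik, neg_zero, neg_zero]
      · rw [a1, neg_zero, neg_zero]
      · rw [h12, hsorted k j i hjk hij, neg_zero, neg_zero, neg_zero]

/-- The coefficients of a three-form in a canonical frame satisfy a linear system of differential
equations, here encoded by the derivatives of those coefficients that vanish identically or are
constant multiples of `f 0 3 6`. If `f 0 1 k = 0` for all `k`, then `f` is a multiple of the
coefficients of a fixed invariant form, and all but one of the Wilczynski invariants vanish
wherever `f` does not. -/
theorem threeForm_system {I : Set ℝ} {b c κ' : ℝ → ℝ} {θ : ℕ → ℝ → ℝ}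
    {f : Fin 7 → Fin 7 → Fin 7 → ℝ → ℝ} {A : ℝ → Matrix (Fin 7) (Fin 7) ℝ}
    (hA : ∀ s, A s = canonicalMatrix (b s) (c s) fun m => θ m s)
    (h12 : ∀ i j k s, f i j k s = -f j i k s) (h23 : ∀ i j k s, f i j k s = -f i k j s)
    (hf : ∀ i j k r, (∀ s ∈ I, f i j k s = r * f 0 3 6 s) → ∀ s ∈ I,
      ∑ l, (A s l i * f l j k s + A s l j * f i l k s + A s l k * f i j l s) = r * κ' s)
    (h01 : ∀ k, ∀ s ∈ I, f 0 1 k s = 0) :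
    ∀ s ∈ I, (f 0 3 6 s = 0 → ∀ i j k, f i j k s = 0) ∧ f 0 3 6 s * θ 3 s = 0 ∧
      f 0 3 6 s * θ 4 s = 0 ∧ f 0 3 6 s * θ 5 s = 0 ∧ f 0 3 6 s * θ 7 s = 0 := by
  have a1 : ∀ i k s, f i i k s = 0 := fun i k s => by linarith [h12 i i k s]
  have a2 : ∀ i k s, f i k k s = 0 := fun i k s => by linarith [h23 i k k s]
  have s1 : ∀ i j k s, j < i → f i j k s = -f j i k s := fun i j k s _ => h12 i j k s
  have s2 : ∀ i j k s, k < j → f i j k s = -f i k j s := fun i j k s _ => h23 i j k s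
  simp only [hA, canonicalMatrix_eq, Fin.sum_univ_seven] at hf
  have hz : ∀ i j k, (∀ s ∈ I, f i j k s = 0) → _ := fun i j k h =>
    hf i j k 0 fun s hs => by rw [h s hs, zero_mul]
  -- `Zn` treats the entries of index sum n. In the derivative of an entry, x raises the index sum
  -- by one, h preserves it and yᵐ lowers it by m. Hence differentiating the known entries of sum n
  -- - 1 gives linear equations for those of sum n.
  have Z3 : ∀ s ∈ I, f 0 1 2 s = 0 := fun s hs => h01 2 s hs
  have Z4 : ∀ s ∈ I, f 0 1 3 s = 0 := fun s hs => h01 3 s hs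
  have Z5 : ∀ s ∈ I, f 0 1 4 s = 0 ∧ f 0 2 3 s = 0 := by
    intro s hs
    have e013 := hz 0 1 3 (fun s hs => by simp [Z4 s hs]) s hs
    simp [a1, a2, s1, s2, Z3 s hs, Z4 s hs] at e013
    refine ⟨?_, ?_⟩ <;> linarith [h01 4 s hs]
  have Z6 : ∀ s ∈ I, f 0 1 5 s = 0 ∧ f 0 2 4 s = 0 ∧ f 1 2 3 s = 0 := by
    intro s hs
    have e014 := hz 0 1 4 (fun s hs => by simp [Z5 s hs]) s hs
    have e023 := hz 0 2 3 (fun s hs => by simp [Z5 s hs]) s hs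
    simp [a1, a2, s1, s2, Z3 s hs, Z4 s hs, Z5 s hs] at e014 e023
    refine ⟨?_, ?_, ?_⟩ <;> linarith [h01 5 s hs]
  have Z7 : ∀ s ∈ I, f 0 1 6 s = 0 ∧ f 0 2 5 s = 0 ∧ f 0 3 4 s = 0 ∧ f 1 2 4 s = 0 := by
    intro s hs
    have e015 := hz 0 1 5 (fun s hs => by simp [Z6 s hs]) s hs
    have e024 := hz 0 2 4 (fun s hs => by simp [Z6 s hs]) s hs
    have e123 := hz 1 2 3 (fun s hs => by simp [Z6 s hs]) s hs
    simp [a1, a2, s1, s2, Z3 s hs, Z4 s hs, Z5 s hs, Z6 s hs] at e015 e024 e123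
    refine ⟨?_, ?_, ?_, ?_⟩ <;> linarith [h01 6 s hs]
  have Z8 : ∀ s ∈ I, f 0 2 6 s = 0 ∧ f 0 3 5 s = 0 ∧ f 1 2 5 s = 0 ∧ f 1 3 4 s = 0 := by
    intro s hs
    have e016 := hz 0 1 6 (fun s hs => by simp [Z7 s hs]) s hs
    have e025 := hz 0 2 5 (fun s hs => by simp [Z7 s hs]) s hs
    have e034 := hz 0 3 4 (fun s hs => by simp [Z7 s hs]) s hs
    have e124 := hz 1 2 4 (fun s hs => by simp [Z7 s hs]) s hs
    simp [a1, a2, s1, s2, Z3 s hs, Z4 s hs, Z5 s hs, Z6 s hs, Z7 s hs] at e016 e025 e034 e124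
    refine ⟨?_, ?_, ?_, ?_⟩ <;> linarith []
  -- Sum 9 is weight zero: four equations for five entries leave one free parameter, the multiple of
  -- the `sl₂`-invariant form.
  have Z9 : ∀ s ∈ I, f 1 2 6 s = -1 * f 0 3 6 s ∧ f 1 3 5 s = 1 * f 0 3 6 s ∧
      f 0 4 5 s = -2 * f 0 3 6 s ∧ f 2 3 4 s = -1 * f 0 3 6 s := by
    intro s hs
    have e026 := hz 0 2 6 (fun s hs => by simp [Z8 s hs]) s hs
    have e035 := hz 0 3 5 (fun s hs => by simp [Z8 s hs]) s hs
    have e125 := hz 1 2 5 (fun s hs => by simp [Z8 s hs]) s hs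
    have e134 := hz 1 3 4 (fun s hs => by simp [Z8 s hs]) s hs
    simp [a1, a2, s1, s2, Z3 s hs, Z4 s hs, Z5 s hs, Z6 s hs, Z7 s hs, Z8 s hs] at e026 e035 e125 e134
    refine ⟨?_, ?_, ?_, ?_⟩ <;> linarith []
  -- The five equations have five unknowns: the four entries and the derivative `κ'`. The h-terms
  -- drop out in weight zero.
  have Z10 : ∀ s ∈ I, f 0 4 6 s = 0 ∧ f 1 3 6 s = 0 ∧ f 1 4 5 s = 0 ∧ f 2 3 5 s = 0 := by
    intro s hs
    have e036 := hf 0 3 6 (1) (fun s hs => by linarith [Z9 s hs]) s hs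
    have e045 := hf 0 4 5 (-2) (fun s hs => by linarith [Z9 s hs]) s hs
    have e126 := hf 1 2 6 (-1) (fun s hs => by linarith [Z9 s hs]) s hs
    have e135 := hf 1 3 5 (1) (fun s hs => by linarith [Z9 s hs]) s hs
    have e234 := hf 2 3 4 (-1) (fun s hs => by linarith [Z9 s hs]) s hs
    simp [a1, a2, s1, s2, Z3 s hs, Z4 s hs, Z5 s hs, Z6 s hs, Z7 s hs, Z8 s hs, Z9 s hs] at e036 e045 e126 e135 e234
    refine ⟨?_, ?_, ?_, ?_⟩ <;> linarith []
  have Z11 : ∀ s ∈ I, f 0 5 6 s = 0 ∧ f 1 4 6 s = 0 ∧ f 2 3 6 s = 0 ∧ f 2 4 5 s = 0 := by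
    intro s hs
    have e046 := hz 0 4 6 (fun s hs => by simp [Z10 s hs]) s hs
    have e136 := hz 1 3 6 (fun s hs => by simp [Z10 s hs]) s hs
    have e145 := hz 1 4 5 (fun s hs => by simp [Z10 s hs]) s hs
    have e235 := hz 2 3 5 (fun s hs => by simp [Z10 s hs]) s hs
    simp [a1, a2, s1, s2, Z4 s hs, Z5 s hs, Z6 s hs, Z7 s hs, Z8 s hs, Z9 s hs, Z10 s hs] at e046 e136 e145 e235
    refine ⟨?_, ?_, ?_, ?_⟩ <;> linarith []
  -- From here on there is one equation more than there are entries. The surplus equation isolates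
  -- the term in which a power of y lowers the sum back to 9: y² here, y³ and y⁴ in the next two
  -- steps.
  have Z12 : ∀ s ∈ I, f 1 5 6 s = 0 ∧ f 2 4 6 s = 0 ∧ f 3 4 5 s = 0 ∧ f 0 3 6 s * θ 3 s = 0 := by
    intro s hs
    have e056 := hz 0 5 6 (fun s hs => by simp [Z11 s hs]) s hs
    have e146 := hz 1 4 6 (fun s hs => by simp [Z11 s hs]) s hs
    have e236 := hz 2 3 6 (fun s hs => by simp [Z11 s hs]) s hs
    have e245 := hz 2 4 5 (fun s hs => by simp [Z11 s hs]) s hs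
    simp [a1, a2, s1, s2, Z5 s hs, Z6 s hs, Z7 s hs, Z8 s hs, Z9 s hs, Z10 s hs, Z11 s hs] at e056 e146 e236 e245
    refine ⟨?_, ?_, ?_, ?_⟩ <;> linarith []
  have Z13 : ∀ s ∈ I, f 2 5 6 s = 0 ∧ f 3 4 6 s = 0 ∧ f 0 3 6 s * θ 4 s = 0 := by
    intro s hs
    have e156 := hz 1 5 6 (fun s hs => by simp [Z12 s hs]) s hs
    have e246 := hz 2 4 6 (fun s hs => by simp [Z12 s hs]) s hs
    have e345 := hz 3 4 5 (fun s hs => by simp [Z12 s hs]) s hs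
    simp [a1, a2, s1, s2, Z6 s hs, Z7 s hs, Z8 s hs, Z9 s hs, Z10 s hs, Z11 s hs, Z12 s hs] at e156 e246 e345
    refine ⟨?_, ?_, ?_⟩ <;> linarith []
  have Z14 : ∀ s ∈ I, f 3 5 6 s = 0 ∧ f 0 3 6 s * θ 5 s = 0 := by
    intro s hs
    have e256 := hz 2 5 6 (fun s hs => by simp [Z13 s hs]) s hs
    have e346 := hz 3 4 6 (fun s hs => by simp [Z13 s hs]) s hs
    simp [a1, a2, s1, s2, Z7 s hs, Z8 s hs, Z9 s hs, Z10 s hs, Z11 s hs, Z12 s hs, Z13 s hs] at e256 e346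
    refine ⟨?_, ?_⟩ <;> linarith []
  -- There is no surplus equation here: the θ₆ terms cancel because y⁵ annihilates the invariant
  -- form. The last equation, from the derivative of this entry, then gives θ₇.
  have Z15 : ∀ s ∈ I, f 4 5 6 s = 0 := by
    intro s hs
    have e356 := hz 3 5 6 (fun s hs => by simp [Z14 s hs]) s hs
    simp [a1, a2, s1, s2, Z8 s hs, Z9 s hs, Z10 s hs, Z11 s hs, Z12 s hs, Z13 s hs, Z14 s hs] at e356
    linarith []
  intro s hs
  have e456 := hz 4 5 6 (fun s hs => by simp [Z15 s hs]) s hs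
  simp [-mul_eq_zero, a1, a2, s1, s2, Z9 s hs, Z10 s hs, Z11 s hs, Z12 s hs, Z13 s hs, Z14 s hs, Z15 s hs] at e456
  refine ⟨fun h0 => ?_, (Z12 s hs).2.2.2, (Z13 s hs).2.2, (Z14 s hs).2, ?_⟩
  · refine alternatingArray_eq_zero (f := fun i j k => f i j k s) (fun i j k => h12 i j k s)
      (fun i j k => h23 i j k s) ?_
    have z9 := Z9 s hs
    simp only [h0, mul_zero] at z9
    simp [Z3 s hs, Z4 s hs, z9, h0, Z5 s hs, Z6 s hs, Z7 s hs, Z8 s hs, Z10 s hs, Z11 s hs,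
      Z12 s hs, Z13 s hs, Z14 s hs, Z15 s hs]
  · linarith

/-! ## Smooth curves and matrices -/

theorem ContDiffOn.iteratedDeriv_of_isOpen {E : Type*} [NormedAddCommGroup E] [NormedSpace ℝ E]
    {v : ℝ → E} {J : Set ℝ} (hv : ContDiffOn ℝ ∞ v J) (hJ : IsOpen J) (i : ℕ) :
    ContDiffOn ℝ ∞ (iteratedDeriv i v) J := by
  induction i with
  | zero => simpa using hv
  | succ i ih =>
    rw [iteratedDeriv_succ]
    exact ih.deriv_of_isOpen hJ le_rfl

theorem ContDiffOn.hasDerivAt_iteratedDeriv {E : Type*} [NormedAddCommGroup E] [NormedSpace ℝ E]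
    {v : ℝ → E} {J : Set ℝ} (hv : ContDiffOn ℝ ∞ v J) (hJ : IsOpen J) (i : ℕ) {t : ℝ}
    (ht : t ∈ J) : HasDerivAt (iteratedDeriv i v) (iteratedDeriv (i + 1) v t) t := by
  rw [iteratedDeriv_succ]
  exact (((hv.iteratedDeriv_of_isOpen hJ i).contDiffAt (hJ.mem_nhds ht)).differentiableAt
    (by simp)).hasDerivAt

theorem contDiffOn_matrix_det {n : ℕ} {M : ℝ → Matrix (Fin n) (Fin n) ℝ} {I : Set ℝ}
    (h : ∀ i j, ContDiffOn ℝ ∞ (fun t => M t i j) I) :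
    ContDiffOn ℝ ∞ (fun t => (M t).det) I := by
  simp only [Matrix.det_apply]
  refine ContDiffOn.sum fun σ _ => ContDiffOn.const_smul _ ?_
  exact contDiffOn_prod fun i _ => h _ _

theorem contDiffOn_matrix_adjugate {n : ℕ} {M : ℝ → Matrix (Fin n) (Fin n) ℝ} {I : Set ℝ}
    (h : ∀ i j, ContDiffOn ℝ ∞ (fun t => M t i j) I) (i j : Fin n) :
    ContDiffOn ℝ ∞ (fun t => (M t).adjugate i j) I := by
  simp only [Matrix.adjugate_apply]
  refine contDiffOn_matrix_det fun a b => ?_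
  by_cases ha : a = j
  · subst ha
    simpa using contDiffOn_const
  · simpa [Matrix.updateRow_ne ha] using h a b

theorem contDiffOn_matrix_mul {n : ℕ} {M N : ℝ → Matrix (Fin n) (Fin n) ℝ} {I : Set ℝ}
    (hM : ∀ i j, ContDiffOn ℝ ∞ (fun t => M t i j) I)
    (hN : ∀ i j, ContDiffOn ℝ ∞ (fun t => N t i j) I) (i j : Fin n) :
    ContDiffOn ℝ ∞ (fun t => (M t * N t) i j) I := by
  simp only [Matrix.mul_apply]
  exact ContDiffOn.sum fun l _ => (hM i l).mul (hN l j)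

/-! ## Three-forms on linear combinations -/

section ThreeForm

variable {n : ℕ} (Ω : (Fin n → ℝ) [⋀^Fin 3]→ₗ[ℝ] ℝ)

theorem AlternatingMap.three_sum_left {ι : Type*} [Fintype ι] (a : ι → ℝ)
    (x : ι → Fin n → ℝ) (v w : Fin n → ℝ) :
    Ω ![∑ l, a l • x l, v, w] = ∑ l, a l * Ω ![x l, v, w] := by
  have h : ∀ x, Ω.toMultilinearMap.toLinearMap ![0, v, w] 0 x = Ω ![x, v, w] := fun x =>
    congrArg Ω (by funext i; fin_cases i <;> rfl)
  simp only [← h, map_sum, map_smul, smul_eq_mul]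

theorem AlternatingMap.three_swap_left (u v w : Fin n → ℝ) : Ω ![u, v, w] = -Ω ![v, u, w] := by
  rw [← Ω.map_swap _ (show (0 : Fin 3) ≠ 1 by decide)]
  refine congrArg Ω ?_
  funext i
  fin_cases i <;> rfl

theorem AlternatingMap.three_swap_right (u v w : Fin n → ℝ) : Ω ![u, v, w] = -Ω ![u, w, v] := by
  rw [← Ω.map_swap _ (show (1 : Fin 3) ≠ 2 by decide)]
  refine congrArg Ω ?_
  funext i
  fin_cases i <;> rfl

theorem AlternatingMap.three_sum_mid {ι : Type*} [Fintype ι] (a : ι → ℝ)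
    (x : ι → Fin n → ℝ) (u w : Fin n → ℝ) :
    Ω ![u, ∑ l, a l • x l, w] = ∑ l, a l * Ω ![u, x l, w] := by
  rw [Ω.three_swap_left, Ω.three_sum_left, ← Finset.sum_neg_distrib]
  exact Finset.sum_congr rfl fun l _ => by rw [Ω.three_swap_left u, mul_neg]

theorem AlternatingMap.three_sum_right {ι : Type*} [Fintype ι] (a : ι → ℝ)
    (x : ι → Fin n → ℝ) (u v : Fin n → ℝ) :
    Ω ![u, v, ∑ l, a l • x l] = ∑ l, a l * Ω ![u, v, x l] := by
  rw [Ω.three_swap_right, Ω.three_sum_mid, ← Finset.sum_neg_distrib]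
  exact Finset.sum_congr rfl fun l _ => by rw [Ω.three_swap_right u, mul_neg, neg_neg]

theorem AlternatingMap.three_add_mid (u v v' w : Fin n → ℝ) :
    Ω ![u, v + v', w] = Ω ![u, v, w] + Ω ![u, v', w] := by
  simpa using Ω.three_sum_mid (fun _ : Fin 2 => 1) ![v, v'] u w

theorem AlternatingMap.three_smul_mid (c : ℝ) (u v w : Fin n → ℝ) :
    Ω ![u, c • v, w] = c * Ω ![u, v, w] := by
  simpa using Ω.three_sum_mid (fun _ : Fin 1 => c) ![v] u w

theorem AlternatingMap.three_smul_left (c : ℝ) (u v w : Fin n → ℝ) :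
    Ω ![c • u, v, w] = c * Ω ![u, v, w] := by
  simpa using Ω.three_sum_left (fun _ : Fin 1 => c) ![u] v w

theorem AlternatingMap.three_add_left (u u' v w : Fin n → ℝ) :
    Ω ![u + u', v, w] = Ω ![u, v, w] + Ω ![u', v, w] := by
  simpa using Ω.three_sum_left (fun _ : Fin 2 => 1) ![u, u'] v w

theorem AlternatingMap.three_self_left (u w : Fin n → ℝ) : Ω ![u, u, w] = 0 := by
  linarith [Ω.three_swap_left u u w]

end ThreeForm

/-! ## Canonical frames and compatible forms -/

theorem IsCanonicalFrame.exists_hasDerivAt {γ : ℝ → ℙ ℝ (Fin 7 → ℝ)} {I : Set ℝ}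
    {F : ℝ → Matrix (Fin 7) (Fin 7) ℝ} {θ : ℕ → ℝ → ℝ} (hF : IsCanonicalFrame γ I F θ) :
    ∃ b c : ℝ → ℝ, ∀ t ∈ I, ∀ i j, HasDerivAt (fun s => F s i j)
      ((F t * canonicalMatrix (b t) (c t) fun m => θ m t) i j) t := by
  have h : ∀ t, ∃ b c : ℝ, t ∈ I → ∀ i j, HasDerivAt (fun s => F s i j)
      ((F t * canonicalMatrix b c fun m => θ m t) i j) t := by
    intro t
    by_cases ht : t ∈ I
    · obtain ⟨b, c, h⟩ := hF.structure_eq t ht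
      exact ⟨b, c, fun _ => h⟩
    · exact ⟨0, 0, fun h => absurd h ht⟩
  choose b c h using h
  exact ⟨b, c, h⟩

theorem hasDerivAt_matrix_col {n : ℕ} {F : ℝ → Matrix (Fin n) (Fin n) ℝ}
    {A : Matrix (Fin n) (Fin n) ℝ} {t : ℝ}
    (h : ∀ i j, HasDerivAt (fun s => F s i j) ((F t * A) i j) t) (j : Fin n) :
    HasDerivAt (fun s => (F s)ᵀ j) (∑ l, A l j • (F t)ᵀ l) t := by
  rw [hasDerivAt_pi]
  intro i
  refine (h i j).congr_deriv ?_
  simp [Matrix.mul_apply, mul_comm]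

theorem canonicalMatrix_sum_zero (b c : ℝ) (θ : ℕ → ℝ) (e : Fin 7 → Fin 7 → ℝ) :
    ∑ l, canonicalMatrix b c θ l 0 • e l = (6 * b) • e 0 + e 1 := by
  simp [canonicalMatrix_eq, Fin.sum_univ_seven]

theorem IsCanonicalFrame.isSmoothLift {γ : ℝ → ℙ ℝ (Fin 7 → ℝ)} {I : Set ℝ}
    {F : ℝ → Matrix (Fin 7) (Fin 7) ℝ} {θ : ℕ → ℝ → ℝ} (hF : IsCanonicalFrame γ I F θ) :
    IsSmoothLift γ I fun s => (F s)ᵀ 0 :=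
  ⟨contDiffOn_pi.2 fun i => hF.smooth i 0, hF.lifts⟩

/-- F₀′ = 6b F₀ + F₁ lies in the osculating space, and its F₀ part contributes nothing since Ω is
alternating. -/
theorem IsCompatible.frame_eq_zero {γ : ℝ → ℙ ℝ (Fin 7 → ℝ)} {I : Set ℝ} (hI : IsOpen I)
    {F : ℝ → Matrix (Fin 7) (Fin 7) ℝ} {θ : ℕ → ℝ → ℝ} (hF : IsCanonicalFrame γ I F θ)
    {Ω : (Fin 7 → ℝ) [⋀^Fin 3]→ₗ[ℝ] ℝ} (hΩ : IsCompatible γ I Ω) {t : ℝ} (ht : t ∈ I)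
    (w : Fin 7 → ℝ) : Ω ![(F t)ᵀ 0, (F t)ᵀ 1, w] = 0 := by
  obtain ⟨b, c, h⟩ := hF.exists_hasDerivAt
  have hd := (hasDerivAt_matrix_col (h t ht) 0).congr_deriv
    (canonicalMatrix_sum_zero _ _ _ (F t)ᵀ)
  have h1 := hΩ t ht ((F t)ᵀ 0)
    (Submodule.subset_span ⟨I, _, hI, ht, hF.isSmoothLift, 0, le_rfl, by simp⟩)
    ((6 * b t) • (F t)ᵀ 0 + (F t)ᵀ 1)
    (Submodule.subset_span ⟨I, _, hI, ht, hF.isSmoothLift, 1, by norm_num, by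
      rw [iteratedDeriv_one, hd.deriv]⟩) w
  rwa [Ω.three_add_mid, Ω.three_smul_mid, Ω.three_self_left, mul_zero, zero_add] at h1

/-- For fixed w, differentiating Ω(v, v′, w) = 0 gives Ω(v, v″, w) = 0, so the second derivative
comes for free. -/
theorem isCompatible_of_frame_eq_zero {γ : ℝ → ℙ ℝ (Fin 7 → ℝ)} {I : Set ℝ} (hI : IsOpen I)
    {F : ℝ → Matrix (Fin 7) (Fin 7) ℝ} {θ : ℕ → ℝ → ℝ} (hF : IsCanonicalFrame γ I F θ)
    {Ω : (Fin 7 → ℝ) [⋀^Fin 3]→ₗ[ℝ] ℝ}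
    (hΩ : ∀ t ∈ I, ∀ w, Ω ![(F t)ᵀ 0, (F t)ᵀ 1, w] = 0) : IsCompatible γ I Ω := by
  obtain ⟨b, c, h⟩ := hF.exists_hasDerivAt
  have hlift : ∀ {J : Set ℝ} {v : ℝ → Fin 7 → ℝ}, IsSmoothLift γ J v → ∀ s ∈ J ∩ I,
      ∃ μ : ℝ, μ ≠ 0 ∧ v s = μ • (F s)ᵀ 0 := by
    rintro J v hv s ⟨hsJ, hsI⟩
    obtain ⟨h1, h2⟩ := hv.2 s hsJ
    obtain ⟨h3, h4⟩ := hF.lifts s hsI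
    obtain ⟨μ, hμ⟩ := (Projectivization.mk_eq_mk_iff ℝ _ _ h1 h3).1 (h2.trans h4.symm)
    exact ⟨μ, μ.ne_zero, hμ.symm⟩
  intro t ht a ha d hd w
  have key : ∀ d ∈ osculatingSpace γ 2 t, Ω ![(F t)ᵀ 0, d, w] = 0 := by
    intro d hd
    induction hd using Submodule.span_induction with
    | zero => simpa using Ω.three_smul_mid 0 ((F t)ᵀ 0) 0 w
    | add x y _ _ hx hy => rw [Ω.three_add_mid, hx, hy, add_zero]
    | smul r x _ hx => rw [Ω.three_smul_mid, hx, mul_zero]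
    | mem x hx =>
      obtain ⟨J, v, hJ, htJ, hv, i, hi, rfl⟩ := hx
      have hK : IsOpen (J ∩ I) := hJ.inter hI
      -- An arbitrary lift is only known to be pointwise proportional to F₀. Differentiating this
      -- relation between the two lifts avoids differentiating the factor μ.
      have hv0 : ∀ s ∈ J ∩ I, Ω ![(F s)ᵀ 0, v s, w] = 0 := by
        intro s hs
        obtain ⟨μ, -, hμ⟩ := hlift hv s hs
        rw [hμ, Ω.three_smul_mid, Ω.three_self_left, mul_zero]
      have hd0 : ∀ s ∈ J ∩ I, HasDerivAt v (iteratedDeriv 1 v s) s := fun s hs => by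
        simpa using hv.1.hasDerivAt_iteratedDeriv hJ 0 hs.1
      have hv1 : ∀ s ∈ J ∩ I, Ω ![v s, iteratedDeriv 1 v s, w] = 0 := by
        intro s hs
        have hd := (hasDerivAt_matrix_col (h s hs.2) 0).congr_deriv
          (canonicalMatrix_sum_zero _ _ _ (F s)ᵀ)
        have h1 := Ω.hasDerivAt_three hd (hd0 s hs) (hasDerivAt_const s w)
        have h2 : HasDerivAt (fun s => Ω ![(F s)ᵀ 0, v s, w]) 0 s :=
          (hasDerivAt_const s (0 : ℝ)).congr_of_eventuallyEq
            (Filter.eventually_of_mem (hK.mem_nhds hs) hv0)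
        have h3 := h1.unique h2
        obtain ⟨μ, -, hμ⟩ := hlift hv s hs
        rw [hμ, Ω.three_add_left, Ω.three_smul_left, Ω.three_smul_mid, Ω.three_self_left,
          Ω.three_smul_mid, Ω.three_swap_left ((F s)ᵀ 1), hΩ s hs.2,
          (Ω.map_coord_zero 2 rfl : Ω ![(F s)ᵀ 0, μ • (F s)ᵀ 0, 0] = 0)] at h3
        rw [hμ, Ω.three_smul_left]
        linear_combination μ * h3
      have hv2 : ∀ s ∈ J ∩ I, Ω ![v s, iteratedDeriv 2 v s, w] = 0 := by
        intro s hs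
        have h1 := Ω.hasDerivAt_three (hd0 s hs) (hv.1.hasDerivAt_iteratedDeriv hJ 1 hs.1)
          (hasDerivAt_const s w)
        have h2 : HasDerivAt (fun s => Ω ![v s, iteratedDeriv 1 v s, w]) 0 s :=
          (hasDerivAt_const s (0 : ℝ)).congr_of_eventuallyEq
            (Filter.eventually_of_mem (hK.mem_nhds hs) hv1)
        have h3 := h1.unique h2
        rw [Ω.three_self_left,
          (Ω.map_coord_zero 2 rfl : Ω ![v s, iteratedDeriv 1 v s, 0] = 0)] at h3
        linear_combination h3
      obtain ⟨μ, hμ0, hμ⟩ := hlift hv t ⟨htJ, ht⟩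
      have hcancel : ∀ x, Ω ![v t, x, w] = 0 → Ω ![(F t)ᵀ 0, x, w] = 0 := by
        intro x hx
        rw [hμ, Ω.three_smul_left] at hx
        exact (mul_eq_zero.1 hx).resolve_left hμ0
      interval_cases i
      · simpa using hv0 t ⟨htJ, ht⟩
      · exact hcancel _ (hv1 t ⟨htJ, ht⟩)
      · exact hcancel _ (hv2 t ⟨htJ, ht⟩)
  induction ha using Submodule.span_induction with
  | zero => simpa using Ω.three_smul_left 0 0 d w
  | add x y _ _ hx hy => rw [Ω.three_add_left, hx, hy, add_zero]
  | smul r x _ hx => rw [Ω.three_smul_left, hx, mul_zero]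
  | mem x hx =>
    obtain ⟨J, v, hJ, htJ, hv, i, hi, rfl⟩ := hx
    obtain rfl : i = 0 := by omega
    obtain ⟨μ, -, hμ⟩ := hlift hv t ⟨htJ, ht⟩
    rw [iteratedDeriv_zero, hμ, Ω.three_smul_left, key d hd, mul_zero]

/-! ## Compatible forms force the invariants to vanish -/

theorem AlternatingMap.eq_zero_of_matrix_cols {n : ℕ} {Ω : (Fin n → ℝ) [⋀^Fin 3]→ₗ[ℝ] ℝ}
    {M : Matrix (Fin n) (Fin n) ℝ} (hM : M.det ≠ 0)
    (h : ∀ i j k, Ω ![Mᵀ i, Mᵀ j, Mᵀ k] = 0) : Ω = 0 := by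
  have hli : LinearIndependent ℝ Mᵀ :=
    Matrix.linearIndependent_rows_of_det_ne_zero (by rwa [Matrix.det_transpose])
  classical
  let e := basisOfPiSpaceOfLinearIndependent hli
  have he : ∀ i, e i = Mᵀ i := congrFun (coe_basisOfPiSpaceOfLinearIndependent hli)
  refine e.ext_alternating fun v _ => ?_
  rw [AlternatingMap.zero_apply, ← h (v 0) (v 1) (v 2)]
  refine congrArg Ω ?_
  funext i
  fin_cases i <;> simp [he]

theorem wilczynski_eq_zero_of_isCompatible {γ : ℝ → ℙ ℝ (Fin 7 → ℝ)} {I : Set ℝ}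
    (hI : IsOpen I) {F : ℝ → Matrix (Fin 7) (Fin 7) ℝ} {θ : ℕ → ℝ → ℝ}
    (hF : IsCanonicalFrame γ I F θ) {Ω : (Fin 7 → ℝ) [⋀^Fin 3]→ₗ[ℝ] ℝ} (h0 : Ω ≠ 0)
    (hΩ : IsCompatible γ I Ω) {t : ℝ} (ht : t ∈ I) :
    θ 3 t = 0 ∧ θ 4 t = 0 ∧ θ 5 t = 0 ∧ θ 7 t = 0 := by
  obtain ⟨b, c, h⟩ := hF.exists_hasDerivAt
  have hcol := fun s hs j => hasDerivAt_matrix_col (h s hs) j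
  let f : Fin 7 → Fin 7 → Fin 7 → ℝ → ℝ := fun i j k s => Ω ![(F s)ᵀ i, (F s)ᵀ j, (F s)ᵀ k]
  have hder : ∀ i j k, ∀ s ∈ I, HasDerivAt (f i j k)
      (∑ l, (canonicalMatrix (b s) (c s) (fun m => θ m s) l i * f l j k s +
        canonicalMatrix (b s) (c s) (fun m => θ m s) l j * f i l k s +
        canonicalMatrix (b s) (c s) (fun m => θ m s) l k * f i j l s)) s := by
    intro i j k s hs
    refine (Ω.hasDerivAt_three (hcol s hs i) (hcol s hs j) (hcol s hs k)).congr_deriv ?_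
    rw [Finset.sum_add_distrib, Finset.sum_add_distrib]
    exact congrArg₂ (· + ·) (congrArg₂ (· + ·) (Ω.three_sum_left _ (F s)ᵀ _ _)
      (Ω.three_sum_mid _ (F s)ᵀ _ _)) (Ω.three_sum_right _ (F s)ᵀ _ _)
  have key := threeForm_system (I := I) (κ' := deriv (f 0 3 6)) (f := f) (fun _ => rfl)
    (fun i j k s => Ω.three_swap_left _ _ _) (fun i j k s => Ω.three_swap_right _ _ _)
    (fun i j k r hr s hs => by
      refine (hder i j k s hs).unique ?_
      refine (((hder 0 3 6 s hs).differentiableAt.hasDerivAt.const_mul r)).congr_of_eventuallyEq ?_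
      exact Filter.eventually_of_mem (hI.mem_nhds hs) hr)
    (fun k s hs => hΩ.frame_eq_zero hI hF hs _) t ht
  -- Ω does not depend on t, so the vanishing of all its coefficients at a single parameter would
  -- make it zero.
  have hne : f 0 3 6 t ≠ 0 := fun hz => h0
    (AlternatingMap.eq_zero_of_matrix_cols (by rw [hF.det_eq_one t ht]; exact one_ne_zero)
      (key.1 hz))
  exact ⟨(mul_eq_zero.1 key.2.1).resolve_left hne, (mul_eq_zero.1 key.2.2.1).resolve_left hne,
    (mul_eq_zero.1 key.2.2.2.1).resolve_left hne, (mul_eq_zero.1 key.2.2.2.2).resolve_left hne⟩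

/-! ## The invariant three-form -/

/-- The identification of `ℝ⁷` with the imaginary split octonions for which the split `G₂`
contains the irreducible `SL₂` with Lie algebra `⟨x, h, y⟩`. -/
noncomputable def imSplitOctEquiv : (Fin 7 → ℝ) ≃ₗ[ℝ] ImSplitOct where
  -- The scalings make the pulled-back form take the values 1, -2, -1, 1, -1 on the index triples
  -- 036, 045, 126, 135, 234, the ratios forced in `threeForm_system`.
  toFun p := ⟨(p 3, ![p 0, 2 * p 5, 2 * p 4], ![-2 * p 6, p 1, -p 2], -p 3), by
    simp [SplitOct.re]⟩
  map_add' p q := by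
    refine Subtype.ext (Prod.ext rfl (Prod.ext ?_ (Prod.ext ?_ (neg_add _ _))))
    · change ![p 0 + q 0, 2 * (p 5 + q 5), 2 * (p 4 + q 4)] =
        ![p 0, 2 * p 5, 2 * p 4] + ![q 0, 2 * q 5, 2 * q 4]
      simp [mul_add]
    · change ![-2 * (p 6 + q 6), p 1 + q 1, -(p 2 + q 2)] =
        ![-2 * p 6, p 1, -p 2] + ![-2 * q 6, q 1, -q 2]
      simp [mul_add, add_comm]
  map_smul' r p := by
    refine Subtype.ext (Prod.ext rfl (Prod.ext ?_ (Prod.ext ?_ (mul_neg _ _).symm)))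
    · change ![r * p 0, 2 * (r * p 5), 2 * (r * p 4)] = r • ![p 0, 2 * p 5, 2 * p 4]
      simp [mul_left_comm]
    · change ![-2 * (r * p 6), r * p 1, -(r * p 2)] = r • ![-2 * p 6, p 1, -p 2]
      simp [mul_left_comm]
  invFun q := ![q.1.2.1 0, q.1.2.2.1 1, -q.1.2.2.1 2, q.1.1, q.1.2.1 2 / 2, q.1.2.1 1 / 2,
    -q.1.2.2.1 0 / 2]
  left_inv p := by
    funext i
    fin_cases i <;> simp
  right_inv q := by
    obtain ⟨⟨a, u, v, b⟩, hq⟩ := q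
    have hb : b = -a := by
      have : (a + b) / 2 = 0 := hq
      linarith
    subst hb
    refine Subtype.ext (Prod.ext rfl (Prod.ext ?_ (Prod.ext ?_ rfl)))
    · change ![u 0, 2 * (u 1 / 2), 2 * (u 2 / 2)] = u
      funext i
      fin_cases i <;> simp [mul_div_cancel₀]
    · change ![-2 * (-v 0 / 2), v 1, - -v 2] = v
      funext i
      fin_cases i <;> simp [mul_div_cancel₀]

/-- The three-form on `ℝ⁷` which is invariant under the irreducible `SL₂`. -/
noncomputable def invariantForm : (Fin 7 → ℝ) [⋀^Fin 3]→ₗ[ℝ] ℝ :=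
  splitG2Form.compLinearMap imSplitOctEquiv.toLinearMap

theorem splitG2Form_ne_zero : splitG2Form ≠ 0 := by
  intro h
  have h1 := DFunLike.congr_fun h
    (![⟨(0, ![1, 0, 0], 0, 0), by simp [SplitOct.re]⟩,
      ⟨(0, ![0, 1, 0], 0, 0), by simp [SplitOct.re]⟩,
      ⟨(0, ![0, 0, 1], 0, 0), by simp [SplitOct.re]⟩] : Fin 3 → ImSplitOct)
  simp [splitG2Form, SplitOct.mul, SplitOct.re, crossProduct, dotProduct,
    Fin.sum_univ_three] at h1

theorem IsG2Structure.ne_zero {Ω : (Fin 7 → ℝ) [⋀^Fin 3]→ₗ[ℝ] ℝ} (h : IsG2Structure Ω) :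
    Ω ≠ 0 := by
  rintro rfl
  obtain ⟨φ, hφ⟩ := h
  refine splitG2Form_ne_zero (AlternatingMap.ext fun m => ?_)
  have h1 := DFunLike.congr_fun hφ fun i => φ.symm (m i)
  simpa using h1.symm

theorem invariantForm_apply (p q r : Fin 7 → ℝ) : invariantForm ![p, q, r] =
    (p 3 * (q 0 * (-2 * r 6) + 2 * q 5 * r 1 - 2 * q 4 * r 2
        - r 0 * (-2 * q 6) - 2 * r 5 * q 1 + 2 * r 4 * q 2)
      - q 3 * (p 0 * (-2 * r 6) + 2 * p 5 * r 1 - 2 * p 4 * r 2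
        - r 0 * (-2 * p 6) - 2 * r 5 * p 1 + 2 * r 4 * p 2)
      + r 3 * (p 0 * (-2 * q 6) + 2 * p 5 * q 1 - 2 * p 4 * q 2
        - q 0 * (-2 * p 6) - 2 * q 5 * p 1 + 2 * q 4 * p 2)) / 2
      + 2 * (p 0 * (q 5 * r 4 - q 4 * r 5) - p 5 * (q 0 * r 4 - q 4 * r 0)
        + p 4 * (q 0 * r 5 - q 5 * r 0))
      - (p 6 * (q 1 * r 2 - q 2 * r 1) - p 1 * (q 6 * r 2 - q 2 * r 6)
        + p 2 * (q 6 * r 1 - q 1 * r 6)) := by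
  simp [invariantForm, splitG2Form, imSplitOctEquiv, SplitOct.mul, SplitOct.re, crossProduct,
    dotProduct, Fin.sum_univ_three]
  ring

/-- The remaining terms x, h, y and y⁵ all lie in the copy of `g₂` annihilating the form. In
coordinates this is a polynomial identity. -/
theorem invariantForm_canonicalMatrix {b c : ℝ} {θ : ℕ → ℝ} (h3 : θ 3 = 0) (h4 : θ 4 = 0)
    (h5 : θ 5 = 0) (h7 : θ 7 = 0) (p q r : Fin 7 → ℝ) :
    invariantForm ![canonicalMatrix b c θ *ᵥ p, q, r] +
      invariantForm ![p, canonicalMatrix b c θ *ᵥ q, r] +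
      invariantForm ![p, q, canonicalMatrix b c θ *ᵥ r] = 0 := by
  have hv : ∀ p : Fin 7 → ℝ, canonicalMatrix b c θ *ᵥ p =
      ![6 * b * p 0 + 6 * c * p 1 + 86400 * θ 6 * p 5,
        p 0 + 4 * b * p 1 + 10 * c * p 2 + 86400 * θ 6 * p 6,
        p 1 + 2 * b * p 2 + 12 * c * p 3,
        p 2 + 12 * c * p 4,
        p 3 - 2 * b * p 4 + 10 * c * p 5,
        p 4 - 4 * b * p 5 + 6 * c * p 6,
        p 5 - 6 * b * p 6] := by
    intro p
    funext i
    simp only [Matrix.mulVec, dotProduct, canonicalMatrix_eq, Fin.sum_univ_seven, h3, h4, h5, h7]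
    fin_cases i <;> simp <;> ring
  simp only [hv, invariantForm_apply, Matrix.cons_val]
  ring

theorem AlternatingMap.compLinearMap_three {n : ℕ} (Ω : (Fin n → ℝ) [⋀^Fin 3]→ₗ[ℝ] ℝ)
    (ψ : (Fin n → ℝ) →ₗ[ℝ] (Fin n → ℝ)) (p q r : Fin n → ℝ) :
    Ω.compLinearMap ψ ![p, q, r] = Ω ![ψ p, ψ q, ψ r] := by
  refine congrArg Ω ?_
  funext i
  fin_cases i <;> rfl

/-! ## Vanishing invariants give a compatible form -/

/-- As det F = 1, the adjugate is F⁻¹. Differentiating F u = p with F′ = F A gives F (A u + u′) = 0,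
hence u′ = -A u. -/
theorem hasDerivAt_inv_mulVec {n : ℕ} {F A : ℝ → Matrix (Fin n) (Fin n) ℝ} {I : Set ℝ}
    (hI : IsOpen I) (hF : ∀ i j, ContDiffOn ℝ ∞ (fun t => F t i j) I)
    (hdet : ∀ t ∈ I, (F t).det = 1)
    (h : ∀ t ∈ I, ∀ i j, HasDerivAt (fun s => F s i j) ((F t * A t) i j) t) (p : Fin n → ℝ)
    {t : ℝ} (ht : t ∈ I) :
    HasDerivAt (fun s => (F s).adjugate *ᵥ p) (-(A t *ᵥ ((F t).adjugate *ᵥ p))) t := by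
  set u : ℝ → Fin n → ℝ := fun s => (F s).adjugate *ᵥ p with hu
  have hd : DifferentiableAt ℝ u t := by
    rw [differentiableAt_pi]
    intro i
    simp only [hu, Matrix.mulVec, dotProduct]
    refine DifferentiableAt.fun_sum fun j _ => DifferentiableAt.mul_const ?_ _
    exact ((contDiffOn_matrix_adjugate hF i j).contDiffAt (hI.mem_nhds ht)).differentiableAt
      (by simp)
  have hFu : ∀ s ∈ I, F s *ᵥ u s = p := fun s hs => by
    simp only [hu, Matrix.mulVec_mulVec, Matrix.mul_adjugate, hdet s hs, one_smul,
      Matrix.one_mulVec]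
  have hzero : F t *ᵥ (A t *ᵥ u t + deriv u t) = 0 := by
    funext i
    have h1 : HasDerivAt (fun s => (F s *ᵥ u s) i)
        (∑ j, ((F t * A t) i j * u t j + F t i j * deriv u t j)) t := by
      simp only [Matrix.mulVec, dotProduct]
      exact HasDerivAt.fun_sum fun j _ => (h t ht i j).mul (hasDerivAt_pi.1 hd.hasDerivAt j)
    have h2 : HasDerivAt (fun s => (F s *ᵥ u s) i) 0 t :=
      (hasDerivAt_const t (p i)).congr_of_eventuallyEq
        (Filter.eventually_of_mem (hI.mem_nhds ht) fun s hs => congrFun (hFu s hs) i)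
    have h3 := h1.unique h2
    rw [Finset.sum_add_distrib] at h3
    rw [Matrix.mulVec_add, Matrix.mulVec_mulVec]
    exact h3
  have h4 := congrArg ((F t).adjugate *ᵥ ·) hzero
  simp only [Matrix.mulVec_mulVec, Matrix.adjugate_mul, hdet t ht, one_smul, Matrix.one_mulVec,
    Matrix.mulVec_zero] at h4
  rw [← eq_neg_of_add_eq_zero_right h4]
  exact hd.hasDerivAt

theorem exists_isG2Structure_isCompatible {γ : ℝ → ℙ ℝ (Fin 7 → ℝ)} {I : Set ℝ}
    (hI : IsOpen I) (hIc : IsPreconnected I) {F : ℝ → Matrix (Fin 7) (Fin 7) ℝ}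
    {θ : ℕ → ℝ → ℝ} (hF : IsCanonicalFrame γ I F θ) (h3 : ∀ t ∈ I, θ 3 t = 0)
    (h4 : ∀ t ∈ I, θ 4 t = 0) (h5 : ∀ t ∈ I, θ 5 t = 0) (h7 : ∀ t ∈ I, θ 7 t = 0) :
    ∃ Ω : (Fin 7 → ℝ) [⋀^Fin 3]→ₗ[ℝ] ℝ, IsG2Structure Ω ∧ IsCompatible γ I Ω := by
  rcases I.eq_empty_or_nonempty with rfl | ⟨t₀, ht₀⟩
  · exact ⟨invariantForm, ⟨imSplitOctEquiv, rfl⟩, fun t ht => absurd ht (Set.notMem_empty t)⟩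
  obtain ⟨b, c, h⟩ := hF.exists_hasDerivAt
  -- This is the only use of connectedness: infinitesimal invariance makes the transported form
  -- locally constant, hence constant on I.
  have hconst : ∀ p q r, ∀ t ∈ I,
      invariantForm ![(F t₀).adjugate *ᵥ p, (F t₀).adjugate *ᵥ q, (F t₀).adjugate *ᵥ r] =
      invariantForm ![(F t).adjugate *ᵥ p, (F t).adjugate *ᵥ q, (F t).adjugate *ᵥ r] := by
    intro p q r t ht
    have hd : ∀ s ∈ I, HasDerivAt (fun s => invariantForm
        ![(F s).adjugate *ᵥ p, (F s).adjugate *ᵥ q, (F s).adjugate *ᵥ r]) 0 s := by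
      intro s hs
      have hinv := fun p => hasDerivAt_inv_mulVec hI hF.smooth hF.det_eq_one h p hs
      refine (invariantForm.hasDerivAt_three (hinv p) (hinv q) (hinv r)).congr_deriv ?_
      rw [← invariantForm_canonicalMatrix (b := b s) (c := c s) (θ := fun m => θ m s) (h3 s hs)
        (h4 s hs) (h5 s hs) (h7 s hs) (-((F s).adjugate *ᵥ p)) ((F s).adjugate *ᵥ q) ((F s).adjugate *ᵥ r)]
      have hneg : ∀ (v w u : Fin 7 → ℝ), invariantForm ![-v, w, u] = -invariantForm ![v, w, u] :=
        fun v w u => by simpa using invariantForm.three_smul_left (-1) v w u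
      have hneg' : ∀ (v w u : Fin 7 → ℝ), invariantForm ![v, -w, u] = -invariantForm ![v, w, u] :=
        fun v w u => by simpa using invariantForm.three_smul_mid (-1) v w u
      have hneg'' : ∀ (v w u : Fin 7 → ℝ), invariantForm ![v, w, -u] = -invariantForm ![v, w, u] :=
        fun v w u => by
          rw [invariantForm.three_swap_right, hneg', ← invariantForm.three_swap_right]
      simp only [Matrix.mulVec_neg, hneg, hneg', hneg'']
    exact hI.is_const_of_deriv_eq_zero hIc
      (fun s hs => (hd s hs).differentiableAt.differentiableWithinAt)
      (fun s hs => (hd s hs).deriv) ht₀ ht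
  have hmul : F t₀ * (F t₀).adjugate = 1 := by
    rw [Matrix.mul_adjugate, hF.det_eq_one t₀ ht₀, one_smul]
  have hmul' : (F t₀).adjugate * F t₀ = 1 := by
    rw [Matrix.adjugate_mul, hF.det_eq_one t₀ ht₀, one_smul]
  let ψ : (Fin 7 → ℝ) ≃ₗ[ℝ] (Fin 7 → ℝ) := Matrix.toLin'OfInv hmul hmul'
  refine ⟨invariantForm.compLinearMap ψ.toLinearMap,
    ⟨ψ.trans imSplitOctEquiv, AlternatingMap.ext fun _ => rfl⟩,
    isCompatible_of_frame_eq_zero hI hF fun t ht w => ?_⟩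
  have hψ : ∀ p q r, invariantForm.compLinearMap ψ.toLinearMap ![p, q, r] =
      invariantForm ![(F t₀).adjugate *ᵥ p, (F t₀).adjugate *ᵥ q, (F t₀).adjugate *ᵥ r] := by
    intro p q r
    rw [AlternatingMap.compLinearMap_three]
    rfl
  have hcol : ∀ j, (F t).adjugate *ᵥ (F t)ᵀ j = Pi.single j 1 := by
    intro j
    have h1 : (F t)ᵀ j = F t *ᵥ Pi.single j 1 := by
      rw [Matrix.mulVec_single_one]
      rfl
    rw [h1, Matrix.mulVec_mulVec, Matrix.adjugate_mul, hF.det_eq_one t ht, one_smul,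
      Matrix.one_mulVec]
  rw [hψ, hconst _ _ _ t ht, hcol, hcol, invariantForm_apply]
  simp

/-! ## Normalization of moving frames -/

theorem sl2X_mul_apply (N : Matrix (Fin 7) (Fin 7) ℝ) (i j : Fin 7) :
    (sl2X * N) i j = if h : 0 < (i : ℕ) then N ⟨i - 1, by omega⟩ j else 0 := by
  simp only [Matrix.mul_apply, sl2X, Matrix.of_apply, ite_mul, one_mul, zero_mul]
  split_ifs with h
  · rw [Finset.sum_eq_single (⟨i - 1, by omega⟩ : Fin 7)]
    · rw [if_pos (by simp only; omega)]
    · intro l _ hl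
      rw [if_neg]
      exact fun h' => hl (Fin.ext (by simp only; omega))
    · simp
  · exact Finset.sum_eq_zero fun l _ => if_neg (by omega)

theorem mul_sl2X_apply (N : Matrix (Fin 7) (Fin 7) ℝ) (i j : Fin 7) :
    (N * sl2X) i j = if h : (j : ℕ) + 1 < 7 then N i ⟨j + 1, h⟩ else 0 := by
  simp only [Matrix.mul_apply, sl2X, Matrix.of_apply, mul_ite, mul_one, mul_zero]
  split_ifs with h
  · rw [Finset.sum_eq_single (⟨j + 1, h⟩ : Fin 7)]
    · rw [if_pos rfl]
    · intro l _ hl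
      rw [if_neg]
      exact fun h' => hl (Fin.ext h')
    · simp
  · exact Finset.sum_eq_zero fun l _ => if_neg (by omega)

/-- The effect of a gauge transformation `1 + N`, with `N` concentrated on the `(k+1)`-st
superdiagonal, on the entries up to the `k`-th superdiagonal. -/
theorem gauge_apply {k : ℕ} {A A' N N' : Matrix (Fin 7) (Fin 7) ℝ}
    (hN : ∀ i j : Fin 7, (j : ℕ) ≠ i + k + 1 → N i j = 0)
    (hN' : ∀ i j : Fin 7, (j : ℕ) ≠ i + k + 1 → N' i j = 0)
    (hA : ∀ i j, j < i → A i j = sl2X i j) (h : (1 + N) * A' = A * (1 + N) + N') :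
    (∀ i j, j < i → A' i j = sl2X i j) ∧
      (∀ i j : Fin 7, (j : ℕ) < i + k → A' i j = A i j) ∧
      ∀ i j : Fin 7, (j : ℕ) = i + k → A' i j = A i j + (sl2X * N) i j - (N * sl2X) i j := by
  have hrow : ∀ i j : Fin 7, (j : ℕ) ≤ i + k →
      (∀ l, i < l → ∀ j, j < l → A' l j = sl2X l j) →
      A' i j = A i j + (sl2X * N) i j - (N * sl2X) i j := by
    intro i j hj hl
    have h1 : (A * N) i j = (sl2X * N) i j := by
      simp only [Matrix.mul_apply]
      refine Finset.sum_congr rfl fun l _ => ?_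
      by_cases hjl : (j : ℕ) = l + k + 1
      · rw [hA i l (Fin.lt_def.2 (by omega))]
      · rw [hN l j hjl, mul_zero, mul_zero]
    have h2 : (N * A') i j = (N * sl2X) i j := by
      simp only [Matrix.mul_apply]
      refine Finset.sum_congr rfl fun l _ => ?_
      by_cases hil : (l : ℕ) = i + k + 1
      · rw [hl l (Fin.lt_def.2 (by omega)) j (Fin.lt_def.2 (by omega))]
      · rw [hN i l hil, zero_mul, zero_mul]
    have h3 := congrFun (congrFun h i) j
    simp only [add_mul, mul_add, one_mul, mul_one, Matrix.add_apply, h1, h2,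
      hN' i j (by omega)] at h3
    linarith
  have hlow : ∀ i j : Fin 7, (j : ℕ) < i + k → (sl2X * N) i j = 0 ∧ (N * sl2X) i j = 0 := by
    intro i j hj
    rw [sl2X_mul_apply, mul_sl2X_apply]
    constructor
    · split_ifs
      · exact hN _ _ (by simp only; omega)
      · rfl
    · split_ifs
      · exact hN _ _ (by simp only; omega)
      · rfl
  -- Row i of N A′ involves only rows of A′ below i, so the induction runs from the bottom row
  -- upwards.
  have hlower : ∀ n : ℕ, ∀ i : Fin 7, 7 ≤ (i : ℕ) + n → ∀ j, j < i → A' i j = sl2X i j := by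
    intro n
    induction n with
    | zero =>
      intro i hi
      omega
    | succ n ih =>
      intro i hi j hj
      have hj' := Fin.lt_def.1 hj
      rw [hrow i j (by omega) fun l hl => ih l (by have := Fin.lt_def.1 hl; omega)]
      by_cases hjk : (j : ℕ) < i + k
      · rw [(hlow i j hjk).1, (hlow i j hjk).2, add_zero, sub_zero, hA i j hj]
      · omega
  have hlow7 : ∀ i j, j < i → A' i j = sl2X i j := fun i => hlower 7 i (by omega)
  refine ⟨hlow7, fun i j hj => ?_, fun i j hj => hrow i j hj.le fun l _ => hlow7 l⟩
  rw [hrow i j hj.le fun l _ => hlow7 l, (hlow i j hj).1, (hlow i j hj).2, add_zero, sub_zero]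

/-- The `l`-th entry on the `k`-th superdiagonal. -/
def superdiagEntry (k l : ℕ) (M : Matrix (Fin 7) (Fin 7) ℝ) : ℝ :=
  if h : l + k < 7 then M ⟨l, by omega⟩ ⟨l + k, h⟩ else 0

/-- The matrix with `f 0, f 1, …` on the `k`-th superdiagonal. -/
def superdiag (k : ℕ) (f : ℕ → ℝ) : Matrix (Fin 7) (Fin 7) ℝ :=
  Matrix.of fun i j => if (j : ℕ) = i + k then f i else 0

theorem superdiagEntry_sl2Y_pow_sum_pos {k : ℕ} (hk : k < 7) :
    0 < ∑ l ∈ Finset.range 7, superdiagEntry k l (sl2Y ^ k) := by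
  refine Finset.sum_pos' (fun l _ => ?_) ⟨0, by simp, ?_⟩
  · unfold superdiagEntry
    split_ifs with h
    · exact (sl2Y_pow_pos k _ _ rfl).le
    · exact le_rfl
  · rw [superdiagEntry, dif_pos (by omega : 0 + k < 7)]
    exact sl2Y_pow_pos k _ _ rfl

/-- Commutation with x takes differences of consecutive entries, so partial sums of d solve the
equation. At the end of the superdiagonal one of the two terms is missing, and there the zero total
sum is needed. -/
theorem superdiag_commutator {k : ℕ} {d : ℕ → ℝ} (hd : ∀ l, 7 ≤ l + k → d l = 0)
    (hsum : ∑ l ∈ Finset.range 7, d l = 0) {i j : Fin 7} (hij : (j : ℕ) = i + k) :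
    (sl2X * superdiag (k + 1) fun l => ∑ m ∈ Finset.range (l + 1), d m) i j -
      ((superdiag (k + 1) fun l => ∑ m ∈ Finset.range (l + 1), d m) * sl2X) i j = -d i := by
  have h1 : (sl2X * superdiag (k + 1) fun l => ∑ m ∈ Finset.range (l + 1), d m) i j =
      ∑ m ∈ Finset.range i, d m := by
    rw [sl2X_mul_apply]
    split_ifs with h
    · simp only [superdiag, Matrix.of_apply]
      rw [if_pos (by omega), Nat.sub_add_cancel h]
    · rw [show (i : ℕ) = 0 by omega, Finset.sum_range_zero]
  have h2 : ((superdiag (k + 1) fun l => ∑ m ∈ Finset.range (l + 1), d m) * sl2X) i j =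
      ∑ m ∈ Finset.range (i + 1), d m := by
    rw [mul_sl2X_apply]
    split_ifs with h
    · simp only [superdiag, Matrix.of_apply]
      rw [if_pos (by omega)]
    · rw [← hsum]
      refine (Finset.sum_subset (Finset.range_subset_range.2 i.2) fun l _ hl => hd l ?_).symm
      rw [Finset.mem_range] at hl
      omega
  rw [h1, h2, Finset.sum_range_succ]
  ring

/-- A smooth moving frame `F` in `SL(7, ℝ)` with first column `v` whose matrix `A = F⁻¹ F'`
agrees with `x + a₀ + a₁ y + ⋯ + aₖ₋₁ yᵏ⁻¹` below the `k`-th superdiagonal. -/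
structure IsNormalizedFrame (I : Set ℝ) (v : ℝ → Fin 7 → ℝ) (k : ℕ)
    (F A : ℝ → Matrix (Fin 7) (Fin 7) ℝ) (a : ℕ → ℝ → ℝ) : Prop where
  smooth_frame : ∀ i j, ContDiffOn ℝ ∞ (fun t => F t i j) I
  smooth_matrix : ∀ i j, ContDiffOn ℝ ∞ (fun t => A t i j) I
  det_eq_one : ∀ t ∈ I, (F t).det = 1
  col_zero : ∀ t ∈ I, ∀ i, F t i 0 = v t i
  hasDerivAt : ∀ t ∈ I, ∀ i j, HasDerivAt (fun s => F s i j) ((F t * A t) i j) t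
  lower : ∀ t ∈ I, ∀ i j, j < i → A t i j = sl2X i j
  upper : ∀ t ∈ I, ∀ m < k, ∀ i j : Fin 7, (j : ℕ) = i + m → A t i j = a m t * (sl2Y ^ m) i j

/-- A gauge change by 1 + N, with N on superdiagonal k + 1, alters superdiagonal k by [x, N] and
nothing before it. Such commutators realize every entry list of sum zero, and yᵏ has positive entry
sum, so the superdiagonal can be made a multiple of yᵏ. -/
theorem IsNormalizedFrame.exists_succ {I : Set ℝ} (hI : IsOpen I) {v : ℝ → Fin 7 → ℝ} {k : ℕ}
    {F A : ℝ → Matrix (Fin 7) (Fin 7) ℝ} {a : ℕ → ℝ → ℝ} (hF : IsNormalizedFrame I v k F A a)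
    (hk : k < 7) : ∃ F' A' b, IsNormalizedFrame I v (k + 1) F' A' (Function.update a k b) := by
  set S : ℝ := ∑ l ∈ Finset.range 7, superdiagEntry k l (sl2Y ^ k) with hS
  have hS0 : S ≠ 0 := (superdiagEntry_sl2Y_pow_sum_pos hk).ne'
  -- This is the coefficient for which the difference `d` from b yᵏ has entry sum zero.
  let b : ℝ → ℝ := fun t => (∑ l ∈ Finset.range 7, superdiagEntry k l (A t)) / S
  let d : ℝ → ℕ → ℝ := fun t l => superdiagEntry k l (A t) - b t * superdiagEntry k l (sl2Y ^ k)
  let n : ℕ → ℝ → ℝ := fun l t => ∑ m ∈ Finset.range (l + 1), d t m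
  let N : ℝ → Matrix (Fin 7) (Fin 7) ℝ := fun t => superdiag (k + 1) fun l => n l t
  let N' : ℝ → Matrix (Fin 7) (Fin 7) ℝ := fun t => superdiag (k + 1) fun l => deriv (n l) t
  have hentry : ∀ l, ContDiffOn ℝ ∞ (fun t => superdiagEntry k l (A t)) I := by
    intro l
    unfold superdiagEntry
    split_ifs
    · exact hF.smooth_matrix _ _
    · exact contDiffOn_const
  have hb : ContDiffOn ℝ ∞ b I := (ContDiffOn.sum fun l _ => hentry l).div_const S
  have hn : ∀ l, ContDiffOn ℝ ∞ (n l) I := fun l =>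
    ContDiffOn.sum fun m _ => (hentry m).sub (hb.mul contDiffOn_const)
  have hN : ∀ i j, ContDiffOn ℝ ∞ (fun t => N t i j) I := by
    intro i j
    simp only [N, superdiag, Matrix.of_apply]
    split_ifs
    · exact hn _
    · exact contDiffOn_const
  have hN' : ∀ i j, ContDiffOn ℝ ∞ (fun t => N' t i j) I := by
    intro i j
    simp only [N', superdiag, Matrix.of_apply]
    split_ifs
    · exact (hn _).deriv_of_isOpen hI le_rfl
    · exact contDiffOn_const
  have hNd : ∀ t ∈ I, ∀ i j, HasDerivAt (fun s => N s i j) (N' t i j) t := by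
    intro t ht i j
    simp only [N, N', superdiag, Matrix.of_apply]
    split_ifs
    · exact (((hn _).contDiffAt (hI.mem_nhds ht)).differentiableAt (by simp)).hasDerivAt
    · exact hasDerivAt_const _ _
  have h1N : ∀ i j, ContDiffOn ℝ ∞ (fun t => (1 + N t) i j) I := fun i j =>
    contDiffOn_const.add (hN i j)
  have hdet : ∀ t, (1 + N t).det = 1 := by
    intro t
    have hu : (1 + N t).IsUpperTriangular := by
      intro i j hij
      have hij' : j < i := hij
      have := Fin.lt_def.1 hij'
      simp only [N, superdiag, Matrix.add_apply, Matrix.of_apply]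
      rw [Matrix.one_apply_ne hij'.ne', if_neg (by omega), add_zero]
    rw [Matrix.det_of_isUpperTriangular hu]
    refine Finset.prod_eq_one fun i _ => ?_
    simp only [N, superdiag, Matrix.add_apply, Matrix.of_apply]
    rw [Matrix.one_apply_eq, if_neg (by omega), add_zero]
  -- The gauge formula A′ = (1 + N)⁻¹ (A (1 + N) + N′), with the adjugate as inverse so that
  -- smoothness is immediate.
  let A' : ℝ → Matrix (Fin 7) (Fin 7) ℝ := fun t =>
    (1 + N t).adjugate * (A t * (1 + N t) + N' t)
  have hA' : ∀ t, (1 + N t) * A' t = A t * (1 + N t) + N' t := fun t => by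
    simp only [A']
    rw [← mul_assoc, Matrix.mul_adjugate, hdet, one_smul, one_mul]
  have hgauge := fun t (ht : t ∈ I) => gauge_apply (k := k) (N := N t) (N' := N' t)
    (fun i j hij => if_neg hij) (fun i j hij => if_neg hij) (hF.lower t ht) (hA' t)
  refine ⟨fun t => F t * (1 + N t), A', b, contDiffOn_matrix_mul hF.smooth_frame h1N,
    contDiffOn_matrix_mul (contDiffOn_matrix_adjugate h1N) fun i j =>
      (contDiffOn_matrix_mul hF.smooth_matrix h1N i j).add (hN' i j),
    fun t ht => ?_, fun t ht i => ?_, fun t ht i j => ?_, fun t ht => (hgauge t ht).1,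
    fun t ht m hm i j hij => ?_⟩
  · rw [Matrix.det_mul, hF.det_eq_one t ht, hdet, one_mul]
  · rw [← hF.col_zero t ht i, mul_add, mul_one, Matrix.add_apply, add_eq_left, Matrix.mul_apply]
    refine Finset.sum_eq_zero fun l _ => ?_
    simp only [N, superdiag, Matrix.of_apply]
    rw [if_neg (by simp), mul_zero]
  · rw [mul_assoc, hA', mul_add, ← mul_assoc, Matrix.add_apply]
    simp only [Matrix.mul_apply (M := F _), Matrix.mul_apply (M := F t * A t)]
    rw [← Finset.sum_add_distrib]
    exact HasDerivAt.fun_sum fun l _ =>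
      (hF.hasDerivAt t ht i l).mul ((hNd t ht l j).const_add ((1 : Matrix _ _ ℝ) l j))
  · rcases (Nat.lt_succ_iff_lt_or_eq.1 hm) with hm | rfl
    · rw [(hgauge t ht).2.1 i j (by omega), Function.update_of_ne hm.ne]
      exact hF.upper t ht m hm i j hij
    · have hcomm := superdiag_commutator (k := m) (d := d t) (fun l hl => by
          simp only [d, superdiagEntry]
          rw [dif_neg (by omega), dif_neg (by omega), mul_zero, sub_zero])
        (by
          simp only [d]
          rw [Finset.sum_sub_distrib, ← Finset.mul_sum, ← hS]
          simp only [b]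
          rw [div_mul_cancel₀ _ hS0, sub_self]) hij
      have hent : ∀ M : Matrix (Fin 7) (Fin 7) ℝ, superdiagEntry m i M = M i j := by
        intro M
        have hlt : (i : ℕ) + m < 7 := hij ▸ j.2
        rw [superdiagEntry, dif_pos hlt]
        exact congrArg (M i) (Fin.ext hij.symm)
      rw [(hgauge t ht).2.2 i j hij, add_sub_assoc, Function.update_self]
      refine (congrArg (A t i j + ·) hcomm).trans ?_
      simp only [d, hent]
      ring

theorem IsNormalizedFrame.exists_seven {I : Set ℝ} (hI : IsOpen I) {v : ℝ → Fin 7 → ℝ}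
    {F A : ℝ → Matrix (Fin 7) (Fin 7) ℝ} {a : ℕ → ℝ → ℝ} (hF : IsNormalizedFrame I v 1 F A a) :
    ∃ F' A' a', IsNormalizedFrame I v 7 F' A' a' ∧ a' 0 = a 0 := by
  have h : ∀ k, k < 7 → ∃ F' A' a', IsNormalizedFrame I v (k + 1) F' A' a' ∧ a' 0 = a 0 := by
    intro k
    induction k with
    | zero => exact fun _ => ⟨F, A, a, hF, rfl⟩
    | succ k ih =>
      intro hk
      obtain ⟨F', A', a', h', h0⟩ := ih (by omega)
      obtain ⟨F'', A'', b, h''⟩ := h'.exists_succ hI hk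
      exact ⟨F'', A'', _, h'', by rw [Function.update_of_ne (by omega), h0]⟩
  exact h 6 (by norm_num)

theorem IsNormalizedFrame.isCanonicalFrame {γ : ℝ → ℙ ℝ (Fin 7 → ℝ)} {I : Set ℝ}
    {v : ℝ → Fin 7 → ℝ} (hv : ∀ t ∈ I, ∃ h : v t ≠ 0, Projectivization.mk ℝ (v t) h = γ t)
    {F A : ℝ → Matrix (Fin 7) (Fin 7) ℝ} {a : ℕ → ℝ → ℝ} (hF : IsNormalizedFrame I v 7 F A a)
    (ha : ∀ t ∈ I, a 0 t = 0) : IsCanonicalFrame γ I F fun m => a (m - 1) := by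
  -- The diagonal of A is zero by `ha`, so h enters with coefficient 0. The coefficient of y is `a
  -- 1`.
  refine ⟨hF.smooth_frame, hF.det_eq_one, fun t ht => ?_, fun t ht => ⟨0, a 1 t, ?_⟩⟩
  · have h : (fun i => F t i 0) = v t := funext (hF.col_zero t ht)
    rw [h]
    exact hv t ht
  · have hA : A t = sl2X + (0 : ℝ) • sl2H + a 1 t • sl2Y +
        ∑ m ∈ Finset.Icc 3 7, a (m - 1) t • sl2Y ^ (m - 1) := by
      have hsum : a 1 t • sl2Y + ∑ m ∈ Finset.Icc 3 7, a (m - 1) t • sl2Y ^ (m - 1) =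
          ∑ m ∈ Finset.range 7, a m t • sl2Y ^ m := by
        have h : Finset.Icc 3 7 = {3, 4, 5, 6, 7} := by decide
        simp [h, Finset.sum_range_succ, ha t ht, add_assoc]
      rw [zero_smul, add_zero, add_assoc, hsum]
      ext i j
      simp only [Matrix.add_apply, Matrix.sum_apply, Matrix.smul_apply, smul_eq_mul]
      rcases lt_or_ge j i with hij | hij
      · rw [hF.lower t ht i j hij, Finset.sum_eq_zero, add_zero]
        intro m _
        have := Fin.lt_def.1 hij
        rw [sl2Y_pow_apply, if_neg (by omega), mul_zero]
      · have hij' := Fin.le_def.1 hij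
        obtain ⟨m, hm⟩ := Nat.exists_eq_add_of_le hij'
        rw [hF.upper t ht m (by omega) i j hm, Finset.sum_eq_single m]
        · rw [sl2X, Matrix.of_apply, if_neg (by omega), zero_add]
        · intro l _ hl
          rw [sl2Y_pow_apply, if_neg (by omega), mul_zero]
        · intro h
          rw [Finset.mem_range] at h
          omega
    intro i j
    rw [← hA]
    exact hF.hasDerivAt t ht i j

/-! ## Normalized lifts -/

/-- The Wronskian matrix, with columns `v, v', …, v⁽⁶⁾`. -/
noncomputable def wronskianMatrix (v : ℝ → Fin 7 → ℝ) (t : ℝ) : Matrix (Fin 7) (Fin 7) ℝ :=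
  Matrix.of fun i j => iteratedDeriv j v t i

theorem contDiffOn_wronskianMatrix {v : ℝ → Fin 7 → ℝ} {J : Set ℝ} (hJ : IsOpen J)
    (hv : ContDiffOn ℝ ∞ v J) (i j : Fin 7) :
    ContDiffOn ℝ ∞ (fun t => wronskianMatrix v t i j) J :=
  contDiffOn_pi.1 (hv.iteratedDeriv_of_isOpen hJ j) i

theorem wronskianMatrix_congr {v w : ℝ → Fin 7 → ℝ} {t : ℝ} (h : v =ᶠ[nhds t] w) :
    wronskianMatrix v t = wronskianMatrix w t := by
  ext i j
  exact congrFun (h.iteratedDeriv_eq j) i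

theorem iteratedDeriv_smul_eq_sum {E : Type*} [NormedAddCommGroup E] [NormedSpace ℝ E] {n : ℕ}
    {f : ℝ → ℝ} {g : ℝ → E} {t : ℝ} (hf : ContDiffAt ℝ n f t) (hg : ContDiffAt ℝ n g t) :
    iteratedDeriv n (f • g) t = ∑ i ∈ Finset.range (n + 1),
      n.choose i • iteratedDeriv i f t • iteratedDeriv (n - i) g t := by
  simpa using iteratedDerivWithin_smul (Set.mem_univ t) uniqueDiffOn_univ
    hf.contDiffWithinAt hg.contDiffWithinAt

theorem det_wronskianMatrix_smul {μ : ℝ → ℝ} {v : ℝ → Fin 7 → ℝ} {t : ℝ}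
    (hμ : ContDiffAt ℝ ∞ μ t) (hv : ContDiffAt ℝ ∞ v t) :
    (wronskianMatrix (μ • v) t).det = μ t ^ 7 * (wronskianMatrix v t).det := by
  -- By the Leibniz rule the two Wronskian matrices differ by this triangular factor, whose diagonal
  -- entries are all μ.
  let T : Matrix (Fin 7) (Fin 7) ℝ := Matrix.of fun l j =>
    if l ≤ j then ((j : ℕ).choose l : ℝ) * iteratedDeriv ((j : ℕ) - l) μ t else 0
  have hT : wronskianMatrix (μ • v) t = wronskianMatrix v t * T := by
    ext i j
    have hle : ∀ n : ℕ, (n : ℕ∞ω) ≤ ∞ := fun n => by exact_mod_cast le_top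
    rw [wronskianMatrix, Matrix.of_apply, iteratedDeriv_smul_eq_sum (hμ.of_le (hle j)) (hv.of_le (hle j)),
      ← Finset.sum_range_reflect, Matrix.mul_apply]
    simp only [T, Matrix.of_apply, wronskianMatrix, Fin.le_def]
    rw [Fin.sum_univ_eq_sum_range (fun l => iteratedDeriv l v t i *
      if l ≤ (j : ℕ) then ((j : ℕ).choose l : ℝ) * iteratedDeriv ((j : ℕ) - l) μ t else 0) 7,
      Finset.sum_apply]
    rw [← Finset.sum_subset (Finset.range_subset_range.2 (show (j : ℕ) + 1 ≤ 7 from j.2))]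
    · refine Finset.sum_congr rfl fun l hl => ?_
      have hl' : l ≤ (j : ℕ) := Nat.lt_succ_iff.1 (Finset.mem_range.1 hl)
      rw [if_pos hl', show (j : ℕ) + 1 - 1 - l = j - l by omega, Nat.choose_symm hl',
        Nat.sub_sub_self hl']
      simp only [Pi.smul_apply, smul_eq_mul, nsmul_eq_mul]
      ring
    · intro l _ hl
      rw [if_neg (fun h => hl (Finset.mem_range.2 (Nat.lt_succ_iff.2 h))), mul_zero]
  have hdet : T.det = μ t ^ 7 := by
    have hu : T.IsUpperTriangular := fun l j hlj => if_neg (not_le.2 hlj)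
    rw [Matrix.det_of_isUpperTriangular hu]
    simp [T]
  rw [hT, Matrix.det_mul, hdet, mul_comm]

theorem exists_normalized_lift_at {γ : ℝ → ℙ ℝ (Fin 7 → ℝ)} {I : Set ℝ}
    (hγ : IsNondegenerateCurve γ I) {t : ℝ} (ht : t ∈ I) :
    ∃ (J : Set ℝ) (v : ℝ → Fin 7 → ℝ), IsOpen J ∧ t ∈ J ∧ IsSmoothLift γ J v ∧
      ∀ s ∈ J, (wronskianMatrix v s).det = 1 := by
  obtain ⟨J, v, hJ, htJ, hv, hli⟩ := hγ t ht
  have hW : ContDiffOn ℝ ∞ (fun s => (wronskianMatrix v s).det) J :=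
    contDiffOn_matrix_det (contDiffOn_wronskianMatrix hJ hv.1)
  have hne : (wronskianMatrix v t).det ≠ 0 := by
    have hu := Matrix.linearIndependent_cols_iff_isUnit.1
      (show LinearIndependent ℝ (wronskianMatrix v t).col from hli t htJ)
    exact ((Matrix.isUnit_iff_isUnit_det _).1 hu).ne_zero
  -- The sign ε makes the base of the real power positive. As ε⁷ = ε, it also corrects the sign of
  -- the determinant.
  obtain ⟨ε, hε, hpos⟩ : ∃ ε : ℝ, ε ^ 2 = 1 ∧ 0 < ε * (wronskianMatrix v t).det := by
    rcases hne.lt_or_gt with h | h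
    · exact ⟨-1, by norm_num, by linarith⟩
    · exact ⟨1, by norm_num, by linarith⟩
  have hεW : ContDiffOn ℝ ∞ (fun s => ε * (wronskianMatrix v s).det) J := contDiffOn_const.mul hW
  let K : Set ℝ := J ∩ (fun s => ε * (wronskianMatrix v s).det) ⁻¹' Set.Ioi 0
  have hK : IsOpen K := hεW.continuousOn.isOpen_inter_preimage hJ isOpen_Ioi
  let μ : ℝ → ℝ := fun s => ε * (ε * (wronskianMatrix v s).det) ^ (-(1 / 7) : ℝ)
  have hμ : ContDiffOn ℝ ∞ μ K := contDiffOn_const.mul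
    ((hεW.mono Set.inter_subset_left).rpow_const_of_ne fun s hs => ne_of_gt hs.2)
  have hvK : ContDiffOn ℝ ∞ v K := hv.1.mono Set.inter_subset_left
  have hμ7 : ∀ s ∈ K, μ s ^ 7 * (wronskianMatrix v s).det = 1 := by
    intro s hs
    have hs0 : 0 < ε * (wronskianMatrix v s).det := hs.2
    simp only [μ]
    rw [mul_pow, ← Real.rpow_natCast, ← Real.rpow_natCast, ← Real.rpow_mul hs0.le]
    norm_num
    rw [Real.rpow_neg_one]
    have h7 : ε ^ 7 = ε := by
      calc ε ^ 7 = (ε ^ 2) ^ 3 * ε := by ring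
        _ = ε := by rw [hε]; ring
    rw [h7, mul_right_comm, mul_inv_cancel₀ hs0.ne']
  have hμ0 : ∀ s ∈ K, μ s ≠ 0 := by
    intro s hs h0
    have := hμ7 s hs
    rw [h0] at this
    norm_num at this
  refine ⟨K, μ • v, hK, ⟨htJ, hpos⟩, ⟨hμ.smul hvK, fun s hs => ?_⟩, fun s hs => ?_⟩
  · obtain ⟨h0, h1⟩ := hv.2 s hs.1
    refine ⟨smul_ne_zero (hμ0 s hs) h0, ?_⟩
    rw [← h1, Projectivization.mk_eq_mk_iff']
    exact ⟨μ s, rfl⟩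
  · rw [det_wronskianMatrix_smul (hμ.contDiffAt (hK.mem_nhds hs))
      (hvK.contDiffAt (hK.mem_nhds hs)), hμ7 s hs]

/-- The ratio μ of the two lifts satisfies μ⁷ = 1, so μ = 1 because 7 is odd. No sign ambiguity
remains, and local lifts glue. -/
theorem normalized_lift_unique {γ : ℝ → ℙ ℝ (Fin 7 → ℝ)} {J K : Set ℝ} (hJ : IsOpen J)
    (hK : IsOpen K) {v w : ℝ → Fin 7 → ℝ} (hv : IsSmoothLift γ J v) (hw : IsSmoothLift γ K w)
    {t : ℝ} (htJ : t ∈ J) (htK : t ∈ K) (hv1 : (wronskianMatrix v t).det = 1)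
    (hw1 : (wronskianMatrix w t).det = 1) : v t = w t := by
  have hJK : J ∩ K ∈ nhds t := (hJ.inter hK).mem_nhds ⟨htJ, htK⟩
  have hvt := hv.1.contDiffAt (hJ.mem_nhds htJ)
  have hwt := hw.1.contDiffAt (hK.mem_nhds htK)
  have hdot : ∀ {f g : ℝ → Fin 7 → ℝ}, ContDiffAt ℝ ∞ f t → ContDiffAt ℝ ∞ g t →
      ContDiffAt ℝ ∞ (fun s => f s ⬝ᵥ g s) t := fun hf hg =>
    ContDiffAt.sum fun i _ => (contDiffAt_pi.1 hf i).mul (contDiffAt_pi.1 hg i)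
  have hne : ∀ s ∈ J, v s ⬝ᵥ v s ≠ 0 := fun s hs h =>
    (hv.2 s hs).1 (dotProduct_self_eq_zero.1 h)
  -- The explicit quotient shows that the proportionality factor is smooth.
  let μ : ℝ → ℝ := fun s => (w s ⬝ᵥ v s) / (v s ⬝ᵥ v s)
  have hμ : ContDiffAt ℝ ∞ μ t := (hdot hwt hvt).div (hdot hvt hvt) (hne t htJ)
  have hw' : ∀ s ∈ J ∩ K, w s = μ s • v s := by
    intro s hs
    obtain ⟨h1, h2⟩ := hv.2 s hs.1
    obtain ⟨h3, h4⟩ := hw.2 s hs.2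
    obtain ⟨r, hr⟩ := (Projectivization.mk_eq_mk_iff' ℝ _ _ h3 h1).1 (h4.trans h2.symm)
    simp only [μ]
    rw [← hr, smul_dotProduct, smul_eq_mul, mul_div_cancel_right₀ _ (hne s hs.1)]
  have h := det_wronskianMatrix_smul hμ hvt
  rw [hv1, mul_one, ← wronskianMatrix_congr (v := w) (w := μ • v) (Filter.eventually_of_mem hJK hw'), hw1] at h
  have hμ1 : μ t = 1 := (Odd.strictMono_pow (show Odd 7 by decide)).injective (by simp [← h])
  rw [hw' t ⟨htJ, htK⟩, hμ1, one_smul]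

theorem exists_normalized_lift {γ : ℝ → ℙ ℝ (Fin 7 → ℝ)} {I : Set ℝ}
    (hI : IsOpen I) (hγ : IsNondegenerateCurve γ I) :
    ∃ v : ℝ → Fin 7 → ℝ, IsSmoothLift γ I v ∧ ∀ t ∈ I, (wronskianMatrix v t).det = 1 := by
  classical
  choose J V hJ hmem hV hW using fun (t : ℝ) (ht : t ∈ I) => exists_normalized_lift_at hγ ht
  let v : ℝ → Fin 7 → ℝ := fun t => if ht : t ∈ I then V t ht t else 0
  have hv : ∀ t (ht : t ∈ I), v =ᶠ[nhds t] V t ht := by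
    intro t ht
    filter_upwards [(hJ t ht).mem_nhds (hmem t ht), hI.mem_nhds ht] with s hsJ hsI
    simp only [v, dif_pos hsI]
    exact normalized_lift_unique (hJ s hsI) (hJ t ht) (hV s hsI) (hV t ht) (hmem s hsI) hsJ
      (hW s hsI s (hmem s hsI)) (hW t ht s hsJ)
  refine ⟨v, ⟨fun t ht => ?_, fun t ht => ?_⟩, fun t ht => ?_⟩
  · exact ((((hV t ht).1.contDiffAt ((hJ t ht).mem_nhds (hmem t ht)))).congr_of_eventuallyEq
      (hv t ht)).contDiffWithinAt
  · rw [(hv t ht).eq_of_nhds]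
    exact (hV t ht).2 t (hmem t ht)
  · rw [wronskianMatrix_congr (hv t ht)]
    exact hW t ht t (hmem t ht)

/-! ## Existence of canonical frames -/

theorem hasDerivAt_det_rows {n : ℕ} {R : Fin n → ℝ → Fin n → ℝ} {R' : Fin n → Fin n → ℝ} {t : ℝ}
    (hR : ∀ i, HasDerivAt (R i) (R' i) t) :
    HasDerivAt (fun s => Matrix.det fun i => R i s)
      (∑ i, Matrix.det (Matrix.updateRow (fun i => R i t) i (R' i))) t :=
  Matrix.detRowAlternating.toMultilinearMap.hasDerivAt_pi_real hR

/-- Differentiating any column but the last duplicates the column after it, so only one summand of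
the product rule survives. -/
theorem hasDerivAt_det_wronskianMatrix {v : ℝ → Fin 7 → ℝ} {I : Set ℝ} (hI : IsOpen I)
    (hv : ContDiffOn ℝ ∞ v I) {t : ℝ} (ht : t ∈ I) :
    HasDerivAt (fun s => (wronskianMatrix v s).det)
      ((wronskianMatrix v t).updateCol 6 (iteratedDeriv 7 v t)).det t := by
  have hcol : ∀ s, (wronskianMatrix v s)ᵀ = fun i : Fin 7 => iteratedDeriv i v s := fun s => rfl
  have h := hasDerivAt_det_rows fun i : Fin 7 => hv.hasDerivAt_iteratedDeriv hI i ht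
  simp only [← hcol] at h
  simp only [Matrix.det_transpose] at h
  refine h.congr_deriv ?_
  rw [← Matrix.det_transpose ((wronskianMatrix v t).updateCol _ _), ← Matrix.updateRow_transpose,
    Finset.sum_eq_single 6]
  · rfl
  · intro i _ hi
    have hi6 : (i : ℕ) + 1 < 7 := by
      have : (i : ℕ) ≠ 6 := fun h => hi (Fin.ext h)
      omega
    have hne : (⟨i + 1, hi6⟩ : Fin 7) ≠ i := fun h => by
      have := congrArg Fin.val h
      simp at this
    refine Matrix.det_zero_of_row_eq hne.symm ?_
    rw [Matrix.updateRow_self, Matrix.updateRow_ne hne]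
    rfl
  · simp

theorem isNormalizedFrame_wronskianMatrix {v : ℝ → Fin 7 → ℝ} {I : Set ℝ} (hI : IsOpen I)
    (hv : ContDiffOn ℝ ∞ v I) (hdet : ∀ t ∈ I, (wronskianMatrix v t).det = 1) :
    IsNormalizedFrame I v 1 (wronskianMatrix v)
      (fun t => (wronskianMatrix v t).adjugate *
        Matrix.of fun i j : Fin 7 => iteratedDeriv (j + 1) v t i) fun _ _ => 0 := by
  have hentry : ∀ t ∈ I, ∀ i j : Fin 7, (j : ℕ) < 6 → ((wronskianMatrix v t).adjugate *
      Matrix.of fun i j : Fin 7 => iteratedDeriv (j + 1) v t i) i j =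
        if (i : ℕ) = j + 1 then 1 else 0 := by
    intro t ht i j hj
    have h1 := congrFun (congrFun (Matrix.adjugate_mul (wronskianMatrix v t)) i)
      ⟨j + 1, by omega⟩
    rw [hdet t ht, one_smul, Matrix.one_apply] at h1
    simp only [Fin.ext_iff] at h1
    rw [← h1]
    rfl
  refine ⟨contDiffOn_wronskianMatrix hI hv, contDiffOn_matrix_mul
    (contDiffOn_matrix_adjugate (contDiffOn_wronskianMatrix hI hv))
    fun i j => contDiffOn_pi.1 (hv.iteratedDeriv_of_isOpen hI (j + 1)) i, hdet,
    fun t _ i => by simp [wronskianMatrix], fun t ht i j => ?_, fun t ht i j hij => ?_,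
    fun t ht m hm i j hij => ?_⟩
  · rw [← mul_assoc, Matrix.mul_adjugate, hdet t ht, one_smul, one_mul]
    exact hasDerivAt_pi.1 (hv.hasDerivAt_iteratedDeriv hI j ht) i
  · have hij' := Fin.lt_def.1 hij
    rw [hentry t ht i j (by omega)]
    rfl
  · obtain rfl : m = 0 := by omega
    obtain rfl : j = i := Fin.ext hij
    rw [zero_mul]
    by_cases hj : (j : ℕ) < 6
    · rw [hentry t ht j j hj, if_neg (by omega)]
    -- By Cramer's rule the last diagonal entry is the derivative of the Wronskian determinant,
    -- which is constant. This is where normalizing the lift removes the h-term.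
    · obtain rfl : j = 6 := Fin.ext (show (j : ℕ) = 6 by omega)
      have h1 := (hasDerivAt_det_wronskianMatrix hI hv ht).unique
        ((hasDerivAt_const t (1 : ℝ)).congr_of_eventuallyEq
          (Filter.eventually_of_mem (hI.mem_nhds ht) hdet))
      rw [← Matrix.cramer_apply, Matrix.cramer_eq_adjugate_mulVec] at h1
      exact h1

theorem exists_isCanonicalFrame {γ : ℝ → ℙ ℝ (Fin 7 → ℝ)} {I : Set ℝ} (hI : IsOpen I)
    (hγ : IsNondegenerateCurve γ I) : ∃ F θ, IsCanonicalFrame γ I F θ := by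
  obtain ⟨v, hv, hdet⟩ := exists_normalized_lift hI hγ
  obtain ⟨F, A, a, hF, ha⟩ := (isNormalizedFrame_wronskianMatrix hI hv.1 hdet).exists_seven hI
  exact ⟨F, _, hF.isCanonicalFrame hv.2 fun t _ => by rw [ha]⟩

theorem mainTheorem4 (I : Set ℝ) (hIo : IsOpen I) (hIc : IsPreconnected I)
    (γ : ℝ → ℙ ℝ (Fin 7 → ℝ)) (hγ : IsNondegenerateCurve γ I) :
    (∃ θ : ℕ → ℝ → ℝ, IsWilczynskiInvariants γ I θ) ∧
    ∀ θ : ℕ → ℝ → ℝ, IsWilczynskiInvariants γ I θ →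
      ((∃ Ω : (Fin 7 → ℝ) [⋀^Fin 3]→ₗ[ℝ] ℝ, IsG2Structure Ω ∧ IsCompatible γ I Ω) ↔
        ∀ i ∈ Finset.Icc 3 7, i ≠ 6 → ∀ t ∈ I, θ i t = 0) := by
  refine ⟨?_, fun θ hθ => ⟨?_, fun h => ?_⟩⟩
  · obtain ⟨F, θ, hF⟩ := exists_isCanonicalFrame hIo hγ
    exact ⟨θ, F, hF⟩
  · obtain ⟨F, hF⟩ := hθ
    rintro ⟨Ω, hΩ, hc⟩ i hi hi6 t ht
    obtain ⟨h3, h4, h5, h7⟩ := wilczynski_eq_zero_of_isCompatible hIo hF hΩ.ne_zero hc ht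
    obtain ⟨hi3, hi7⟩ := Finset.mem_Icc.1 hi
    interval_cases i
    exacts [h3, h4, h5, absurd rfl hi6, h7]
  · obtain ⟨F, hF⟩ := hθ
    exact exists_isG2Structure_isCompatible hIo hIc hF (h 3 (by decide) (by decide))
      (h 4 (by decide) (by decide)) (h 5 (by decide) (by decide)) (h 7 (by decide) (by decide))
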